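/- Let $d\ge 1$ and let $X$ be a symmetric pure-jump Lévy process in $\mathbb R^d$ with Lévy measure $\nu(dx)=\nu(x)\,dx$ and characteristic exponent $\psi$. That is, $\nu$ is symmetric, $\nu(\{0\})=0$, $\int(|x|^2\wedge 1)\,\nu(dx)<\infty$, and $\mathbb E e^{i\langle\xi,X_t\rangle}=e^{-t\psi(\xi)}$ with $\psi(\xi)=\int_{\mathbb R^d}(1-\cos\langle\xi,x\rangle)\,\nu(dx)$. (A Lévy process is identified here with the weakly continuous convolution semigroup $(p_t)_{t\ge0}$ of its one-dimensional distributions.) Let $\theta\in[0,\infty)$, $c\in(0,1]$ and a nondecreasing function $f:(0,\infty)\to(0,\infty)$ be such that $$c\,\frac{f(1/|x|)}{|x|^d}\le\nu(x)\le c^{-1}\frac{f(1/|x|)}{|x|^d},\qquad 0<|x|<1/\theta ,$$ where $1/0=\infty$. Suppose that there are $\underline\alpha,\overline\alpha\in(0,2)$ and $0<\underline c\le 1\le\overline C<\infty$ such that $$\underline c\,\lambda^{\underline\alpha}f(t)\le f(\lambda t)\le\overline C\,\lambda^{\overline\alpha}f(t),\qquad \lambda\ge1,\ t>\theta .$$ Say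 that functions $g,h\ge0$ are comparable on a set $S$ if there is $C>0$ with $C^{-1}g\le h\le Cg$ on $S$. Then $f(|\xi|)$ and $\psi(\xi)$ are comparable for $|\xi|>\theta$. Moreover, there is a complete subordinate Brownian motion $Z$ that is a symmetric pure-jump Lévy process with Lévy measure $\nu^Z(dx)=\nu^Z(x)\,dx$ and characteristic exponent $\psi^Z$ such that $\psi^Z$ and $\psi$ are comparable for $|\xi|>\theta$, and $\nu^Z(x)$ and $\nu(x)$ are comparable for $0<|x|<1/\theta$. Here a complete subordinate Brownian motion is $Z_t=B_{2\eta_t}$, where $B$ is the standard Brownian motion in $\mathbb R^d$ and $\eta$ is an independent subordinator with $\mathbb E e^{-\lambda\eta_t}=e^{-t\varphi(\lambda)}$, $\lambda>0$, whose Laplace exponent $\varphi$ is a complete Bernstein function, i.e. $\varphi(\lambda)=a+b\lambda+\int_0^\infty(1-e^{-\lambda u})m(u)\,du$ with $a,b\ge0$ and $m$ completely monotone on $(0,\infty)$, $\int_0^\infty(1\wedge u)m(u)\,du<\infty$. -/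

import Mathlib

open MeasureTheory ProbabilityTheory
open scoped NNReal RealInnerProductSpace BoundedContinuousFunction ContDiff

noncomputable section

/-- Weak lower scaling at infinity, `φ ∈ WLSC(α, θ, c)`:
`φ (l * t) ≥ c * l ^ α * φ t` for all `l ≥ 1` and `t > θ`. -/
def WLSC (α θ c : ℝ) (φ : ℝ → ℝ) : Prop :=
  ∀ l t : ℝ, 1 ≤ l → θ < t → c * l ^ α * φ t ≤ φ (l * t)

/-- Weak upper scaling at infinity, `φ ∈ WUSC(α, θ, C)`:
`φ (l * t) ≤ C * l ^ α * φ t` for all `l ≥ 1` and `t > θ`. -/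
def WUSC (α θ C : ℝ) (φ : ℝ → ℝ) : Prop :=
  ∀ l t : ℝ, 1 ≤ l → θ < t → φ (l * t) ≤ C * l ^ α * φ t

/-- `g ≈ h` on `S`: both functions are nonnegative on `S` and there is a comparability constant
`C > 0` with `C⁻¹ * g ≤ h ≤ C * g` on `S`. -/
def ComparableOn {α : Type*} (S : Set α) (g h : α → ℝ) : Prop :=
  (∀ x ∈ S, 0 ≤ g x ∧ 0 ≤ h x) ∧
    ∃ C : ℝ, 0 < C ∧ ∀ x ∈ S, C⁻¹ * g x ≤ h x ∧ h x ≤ C * g x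

/-- A weakly continuous convolution semigroup of Borel probability measures, that is, the family
`p t = law of X t` of one-dimensional distributions of a Lévy process `X` started at `0`. -/
structure IsConvolutionSemigroup {E : Type*} [NormedAddCommGroup E] [MeasurableSpace E]
    (p : ℝ≥0 → Measure E) : Prop where
  isProbabilityMeasure : ∀ t, IsProbabilityMeasure (p t)
  zero : p 0 = Measure.dirac 0
  add : ∀ s t, p (s + t) = (p s).conv (p t)
  continuous : ∀ f : E →ᵇ ℝ, Continuous fun t => ∫ x, f x ∂(p t)

/-- A Lévy measure: it does not charge the origin and `∫ (|x|² ∧ 1) ν(dx) < ∞`. -/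
structure IsLevyMeasure {E : Type*} [NormedAddCommGroup E] [MeasurableSpace E]
    (ν : Measure E) : Prop where
  zero : ν {0} = 0
  lintegral_lt_top : ∫⁻ x, ENNReal.ofReal (min (‖x‖ ^ 2) 1) ∂ν < ⊤

/-- `p` is the convolution semigroup of a symmetric pure-jump Lévy process in `E` with Lévy
measure `ν` and characteristic (Lévy-Khintchine) exponent `ψ`: the measure `ν` is symmetric,
`ψ(ξ) = ∫ (1 - cos ⟨ξ, x⟩) ν(dx)`, and `∫ exp (i ⟨ξ, x⟩) p_t(dx) = exp (-t ψ(ξ))`. -/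
structure IsSymmetricPureJumpLevy {E : Type*} [NormedAddCommGroup E] [InnerProductSpace ℝ E]
    [MeasurableSpace E] (p : ℝ≥0 → Measure E) (ν : Measure E) (ψ : E → ℝ) : Prop where
  semigroup : IsConvolutionSemigroup p
  levyMeasure : IsLevyMeasure ν
  symmetric : ν.map (fun x => -x) = ν
  exponent_eq : ∀ ξ, ψ ξ = ∫ x, (1 - Real.cos ⟪ξ, x⟫) ∂ν
  charFun_eq : ∀ (t : ℝ≥0) (ξ : E), charFun (p t) ξ = Complex.exp (-((t : ℝ) * ψ ξ : ℝ))

/-- `ν(dx) = n(x) dx` with a nonnegative Borel function `n`. -/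
structure HasDensity {E : Type*} [MeasureSpace E] (ν : Measure E) (n : E → ℝ) : Prop where
  measurable : Measurable n
  nonneg : ∀ x, 0 ≤ n x
  eq_withDensity : ν = volume.withDensity fun x => ENNReal.ofReal (n x)

/-- Completely monotone functions on `(0, ∞)`. -/
def IsCompletelyMonotone (m : ℝ → ℝ) : Prop :=
  ContDiffOn ℝ ∞ m (Set.Ioi 0) ∧ ∀ (k : ℕ) (u : ℝ), 0 < u → 0 ≤ (-1) ^ k * iteratedDeriv k m u

/-- Complete Bernstein functions: Bernstein functions
`φ(l) = a + b l + ∫_{(0,∞)} (1 - exp (-l u)) μ(du)`, `l > 0`, whose Lévy measure `μ` has a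
completely monotone density `m` (with `∫ (1 ∧ u) m(u) du < ∞`). -/
def IsCompleteBernstein (φ : ℝ → ℝ) : Prop :=
  ∃ (a b : ℝ) (m : ℝ → ℝ), 0 ≤ a ∧ 0 ≤ b ∧ IsCompletelyMonotone m ∧
    IntegrableOn (fun u => min 1 u * m u) (Set.Ioi 0) ∧
    ∀ l : ℝ, 0 < l → φ l = a + b * l + ∫ u in Set.Ioi (0 : ℝ), (1 - Real.exp (-(l * u))) * m u

/-- `η` is the convolution semigroup of a subordinator with Laplace exponent `φ`:
`η t` lives on `[0, ∞)` and `∫ exp (-l s) η_t(ds) = exp (-t φ(l))` for `l > 0`. -/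
structure IsSubordinator (η : ℝ≥0 → Measure ℝ) (φ : ℝ → ℝ) : Prop where
  semigroup : IsConvolutionSemigroup η
  support : ∀ t, η t (Set.Iio 0) = 0
  laplace_eq : ∀ (t : ℝ≥0) (l : ℝ), 0 < l →
    ∫ s, Real.exp (-(l * s)) ∂(η t) = Real.exp (-((t : ℝ) * φ l))

/-- `q` is the convolution semigroup of a complete subordinate Brownian motion `t ↦ Y (η t)`, where
`Y s = B (2 s)`, `B` is the standard Brownian motion in `E`, and `η` is an independent subordinator
whose Laplace exponent is a complete Bernstein function. Since `B (2 s)` has the law of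
`√(2 s) • G` with `G` standard Gaussian, `q t` is the law of `√(2 s) • x`
under `η_t(ds) ⊗ stdGaussian(dx)`. -/
def IsCompleteSubordinateBrownianMotion {E : Type*} [NormedAddCommGroup E]
    [InnerProductSpace ℝ E] [FiniteDimensional ℝ E] [MeasurableSpace E]
    (q : ℝ≥0 → Measure E) : Prop :=
  ∃ (η : ℝ≥0 → Measure ℝ) (φ : ℝ → ℝ), IsCompleteBernstein φ ∧ IsSubordinator η φ ∧
    ∀ t, q t = ((η t).prod (stdGaussian E)).map fun z => √(2 * z.1) • z.2

end

/-! Comparability of `ψ` with `f`. Put `R = ‖ξ‖ > θ`. Since `1 - cos⟪ξ, x⟫ ≤ 2 min((R‖x‖)², 1)`, the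
two scaling conditions, relating `f (1/‖x‖)` to `f R`, bound the integrand for `θ‖x‖ < 1` by a
constant times `f R` times `R ^ d` times a fixed integrable radial profile at `R‖x‖`. Its integral
does not depend on `R`. The jumps with `θ‖x‖ ≥ 1` contribute a bounded amount, which is absorbed
because `f R ≥ f θ > 0` when `θ > 0`. For the lower bound a ball of radius of order `1/R` where `⟪ξ,
x⟫` stays near `1/2` suffices, with monotonicity of `f` alone (`exists_exponent_le`,
`exists_le_exponent`).

Construction of `Z`. Continue `f` below `θ` by a power, which gives a monotone `g` with scaling on
all of `(0, ∞)` (`exists_global_scaling`). Let the subordinator have as Lévy density `m` the Laplace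
transform of `F s = g (√s)`; this `m` is completely monotone by construction. The upper index is
below `2`, so `F` grows at most linearly, whence `m u` is comparable with `F (1/u) / u`. The Lévy
density of `Z` is the integral of the heat kernel against `m`; the kernel concentrates at `u` of
order `‖x‖²`, so the density is comparable with `g (1/‖x‖) / ‖x‖ ^ d` (`exists_le_jumpDensity`,
`exists_jumpDensity_le`). The exponent estimate, applied to `Z` and `g` with threshold `0`, then
compares both exponents through `g = f` above `θ`.

The process itself has to be produced: `exists_infinitelyDivisible` obtains the subordinator's laws
as limits of convolution powers, and Gaussian mixing together with Tonelli identifies the Lévy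
measure. -/

section SubordinateBrownianMotion

open Filter Topology

/-! ### Characteristic functions and weak convergence -/

/-- A family of probability measures whose characteristic functions are `exp (-t Ψ)` is a weakly
continuous convolution semigroup. -/
theorem isConvolutionSemigroup_of_charFun {E : Type*} [NormedAddCommGroup E]
    [InnerProductSpace ℝ E] [FiniteDimensional ℝ E] [MeasurableSpace E] [BorelSpace E]
    (p : ℝ≥0 → Measure E) (hp : ∀ t, IsProbabilityMeasure (p t)) (Ψ : E → ℂ)
    (h : ∀ (t : ℝ≥0) ξ, charFun (p t) ξ = Complex.exp (-((t : ℝ) * Ψ ξ))) :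
    IsConvolutionSemigroup p where
  isProbabilityMeasure := hp
  zero := by
    apply Measure.ext_of_charFun
    ext ξ
    rw [h, charFun_dirac]
    simp
  add s t := by
    apply Measure.ext_of_charFun
    ext ξ
    rw [charFun_conv, h, h, h, ← Complex.exp_add]
    congr 1
    push_cast
    ring
  continuous f := by
    rw [continuous_iff_seqContinuous]
    intro u a hu
    let P : ℝ≥0 → ProbabilityMeasure E := fun t => ⟨p t, hp t⟩
    have key : Tendsto (fun n => P (u n)) atTop (𝓝 (P a)) := by
      rw [ProbabilityMeasure.tendsto_iff_tendsto_charFun]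
      intro ξ
      simp only [P, ProbabilityMeasure.coe_mk, h]
      have hc : Continuous fun t : ℝ≥0 => Complex.exp (-((t : ℝ) * Ψ ξ)) := by fun_prop
      exact (hc.tendsto a).comp hu
    exact (ProbabilityMeasure.tendsto_iff_forall_integral_tendsto.1 key) f

/-- Lévy's continuity theorem along an ultrafilter: if the characteristic functions converge
pointwise to a function that is continuous at `0`, then there is a limit measure. -/
theorem exists_tendsto_ultrafilter_of_tendsto_charFun {E : Type*} [NormedAddCommGroup E]
    [InnerProductSpace ℝ E] [FiniteDimensional ℝ E] [MeasurableSpace E] [BorelSpace E]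
    (μ : ℕ → Measure E) (hμ : ∀ n, IsProbabilityMeasure (μ n)) {Φ : E → ℂ}
    (hΦ : ContinuousAt Φ 0) (h : ∀ ξ, Tendsto (fun n => charFun (μ n) ξ) atTop (𝓝 (Φ ξ))) :
    ∃ (U : Ultrafilter ℕ) (η : Measure E), (U : Filter ℕ) ≤ atTop ∧ IsProbabilityMeasure η ∧
      ∀ g : E →ᵇ ℂ, Tendsto (fun n => ∫ x, g x ∂(μ n)) U (𝓝 (∫ x, g x ∂η)) := by
  have ht := isTightMeasureSet_of_tendsto_charFun hΦ h
  set ρ : ℕ → ProbabilityMeasure E := fun n => ⟨μ n, hμ n⟩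
  have hc : IsCompact (closure (Set.range ρ)) := by
    apply isCompact_closure_of_isTightMeasureSet
    convert ht using 1
    ext m
    constructor
    · rintro ⟨_, ⟨n, rfl⟩, rfl⟩
      exact ⟨n, rfl⟩
    · rintro ⟨n, rfl⟩
      exact ⟨ρ n, ⟨n, rfl⟩, rfl⟩
  let U : Ultrafilter ℕ := Ultrafilter.of atTop
  obtain ⟨η, -, hη : Tendsto _ _ _⟩ := hc.ultrafilter_le_nhds (U.map ρ)
    (.trans (by simp) (monotone_principal subset_closure))
  refine ⟨U, η, Ultrafilter.of_le _, inferInstance, fun g => ?_⟩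
  rw [ProbabilityMeasure.tendsto_iff_forall_integral_rclike_tendsto ℂ] at hη
  exact hη g

/-! ### Infinitely divisible laws on the half-line -/

theorem norm_exp_le_one_of_re_nonpos {z : ℂ} (hz : z.re ≤ 0) {u : ℝ} (hu : 0 ≤ u) :
    ‖Complex.exp (z * u)‖ ≤ 1 := by
  rw [Complex.norm_exp, Real.exp_le_one_iff]
  simpa using mul_nonpos_of_nonpos_of_nonneg hz hu

/-- The trivial bound `2` handles large `‖z‖ u`, the first-order bound handles small. The result
makes the Lévy-Khintchine integrand integrable against any measure that integrates `min 1 u`, and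
serves as the dominating function below. -/
theorem norm_exp_sub_one_le_min {z : ℂ} (hz : z.re ≤ 0) {u : ℝ} (hu : 0 ≤ u) :
    ‖Complex.exp (z * u) - 1‖ ≤ (2 + 2 * ‖z‖) * min 1 u := by
  have h2 : ‖Complex.exp (z * u) - 1‖ ≤ 2 := by
    refine (norm_sub_le _ _).trans ?_
    have := norm_exp_le_one_of_re_nonpos hz hu
    simp only [norm_one]
    linarith
  have hz0 := norm_nonneg z
  have hn : ‖z * (u : ℂ)‖ = ‖z‖ * u := by simp [abs_of_nonneg hu]
  have h1 : ‖Complex.exp (z * u) - 1‖ ≤ 2 * ‖z‖ * u := by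
    rcases le_total (‖z‖ * u) 1 with h | h
    · have := Complex.norm_exp_sub_one_le (x := z * u) (by rwa [hn])
      rw [hn] at this
      linarith
    · linarith
  rcases le_total 1 u with h | h
  · rw [min_eq_left h]; linarith
  · rw [min_eq_right h]; nlinarith

/-- Convolution powers of a measure on `ℝ`. -/
noncomputable def convPow (σ : Measure ℝ) : ℕ → Measure ℝ
  | 0 => Measure.dirac 0
  | k + 1 => (convPow σ k).conv σ

instance convPow_isProbabilityMeasure (σ : Measure ℝ) [IsProbabilityMeasure σ] (k : ℕ) :
    IsProbabilityMeasure (convPow σ k) := by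
  induction k with
  | zero => simp only [convPow]; infer_instance
  | succ k ih => simp only [convPow]; infer_instance

theorem ae_nonneg_convPow (σ : Measure ℝ) [IsProbabilityMeasure σ] (hσ : ∀ᵐ x ∂σ, 0 ≤ x) (k : ℕ) :
    ∀ᵐ x ∂(convPow σ k), 0 ≤ x := by
  induction k with
  | zero => simp only [convPow]; rw [ae_dirac_iff measurableSet_Ici]
  | succ k ih =>
    simp only [convPow, Measure.conv]
    rw [ae_map_iff (by fun_prop) measurableSet_Ici]
    have h1 := Measure.quasiMeasurePreserving_fst (μ := convPow σ k) (ν := σ) |>.ae ih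
    have h2 := Measure.quasiMeasurePreserving_snd (μ := convPow σ k) (ν := σ) |>.ae hσ
    filter_upwards [h1, h2] with z h1 h2 using add_nonneg h1 h2

theorem integrable_exp_of_ae_nonneg {σ : Measure ℝ} [IsProbabilityMeasure σ]
    (hσ : ∀ᵐ x ∂σ, 0 ≤ x) {z : ℂ} (hz : z.re ≤ 0) :
    Integrable (fun x : ℝ => Complex.exp (z * x)) σ := by
  refine Integrable.mono' (integrable_const (1 : ℝ)) (by fun_prop) ?_
  filter_upwards [hσ] with x hx using norm_exp_le_one_of_re_nonpos hz hx

theorem integral_exp_convPow (σ : Measure ℝ) [IsProbabilityMeasure σ] (hσ : ∀ᵐ x ∂σ, 0 ≤ x)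
    {z : ℂ} (hz : z.re ≤ 0) (k : ℕ) :
    ∫ x, Complex.exp (z * x) ∂(convPow σ k) = (∫ x, Complex.exp (z * x) ∂σ) ^ k := by
  induction k with
  | zero => simp [convPow]
  | succ k ih =>
    have hint := integrable_exp_of_ae_nonneg (ae_nonneg_convPow σ hσ (k + 1)) hz
    simp only [convPow] at hint ⊢
    rw [integral_conv hint, pow_succ, ← ih]
    simp only [Complex.ofReal_add, mul_add, Complex.exp_add, integral_const_mul, integral_mul_const]

/-- Thinned Lévy density, of total mass at most `1`, with `k • thin A k u → 1` as `k → ∞`. -/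
noncomputable def thin (A : ℝ) (k : ℕ) (u : ℝ) : ℝ := min 1 u / (A + k * min 1 u)

theorem thin_nonneg {A : ℝ} (hA : 0 < A) (k : ℕ) {u : ℝ} (hu : 0 ≤ u) : 0 ≤ thin A k u := by
  have : 0 ≤ min 1 u := le_min zero_le_one hu
  unfold thin
  positivity

theorem thin_le {A : ℝ} (hA : 0 < A) (k : ℕ) {u : ℝ} (hu : 0 ≤ u) :
    thin A k u ≤ min 1 u / A := by
  have : 0 ≤ min 1 u := le_min zero_le_one hu
  unfold thin
  gcongr
  have : 0 ≤ k * min 1 u := by positivity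
  linarith

theorem mul_thin_le_one {A : ℝ} (hA : 0 < A) (k : ℕ) {u : ℝ} (hu : 0 ≤ u) :
    k * thin A k u ≤ 1 := by
  have h0 : 0 ≤ min 1 u := le_min zero_le_one hu
  have h1 : 0 ≤ k * min 1 u := by positivity
  unfold thin
  rw [← mul_div_assoc, div_le_one (by positivity)]
  linarith

theorem measurable_thin (A : ℝ) (k : ℕ) : Measurable (thin A k) := by
  unfold thin
  fun_prop

theorem tendsto_mul_thin {A : ℝ} {u : ℝ} (hu : 0 < u) :
    Tendsto (fun k : ℕ => k * thin A k u) atTop (𝓝 1) := by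
  have h0 : 0 < min 1 u := lt_min zero_lt_one hu
  have h1 : Tendsto (fun k : ℕ => A / k + min 1 u) atTop (𝓝 (0 + min 1 u)) :=
    (tendsto_const_div_atTop_nhds_zero_nat A).add tendsto_const_nhds
  have h2 : Tendsto (fun k : ℕ => min 1 u / (A / k + min 1 u)) atTop (𝓝 1) := by
    have : Tendsto (fun k : ℕ => min 1 u / (A / k + min 1 u)) atTop
        (𝓝 (min 1 u / (0 + min 1 u))) := tendsto_const_nhds.div h1 (by simpa using h0.ne')
    rwa [zero_add, div_self h0.ne'] at this
  refine h2.congr' ?_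
  filter_upwards [eventually_gt_atTop 0] with k hk
  have hk' : (k : ℝ) ≠ 0 := by positivity
  unfold thin
  rw [div_add' _ _ _ hk', div_div_eq_mul_div, ← mul_div_assoc]
  ring

/-- The infinitely divisible law on `[0, ∞)` without drift and with Lévy measure `M`. -/
theorem exists_infinitelyDivisible (M : Measure ℝ) (hM0 : ∀ᵐ u ∂M, 0 < u)
    (hM : Integrable (fun u => min 1 u) M) :
    ∃ η : Measure ℝ, IsProbabilityMeasure η ∧ (∀ᵐ x ∂η, 0 ≤ x) ∧ ∀ z : ℂ, z.re ≤ 0 →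
      ∫ x, Complex.exp (z * x) ∂η = Complex.exp (∫ u, (Complex.exp (z * u) - 1) ∂M) := by
  -- `A ≥ ∫ min 1 u ∂M` makes the thinned measure have mass at most `1`; the summand `1` keeps `A`
  -- positive even if `M = 0`.
  set A : ℝ := 1 + ∫ u, min 1 u ∂M with hA_def
  have hI : 0 ≤ ∫ u, min 1 u ∂M := by
    apply integral_nonneg_of_ae
    filter_upwards [hM0] with u hu using le_min zero_le_one hu.le
  have hA : 0 < A := by linarith
  have hthin_int (k : ℕ) : Integrable (thin A k) M := by
    refine (hM.div_const A).mono' (measurable_thin A k).aestronglyMeasurable ?_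
    filter_upwards [hM0] with u hu
    rw [Real.norm_of_nonneg (thin_nonneg hA k hu.le)]
    exact thin_le hA k hu.le
  have hthin_nn (k : ℕ) : 0 ≤ᵐ[M] thin A k := by
    filter_upwards [hM0] with u hu using thin_nonneg hA k hu.le
  have hthin_le (k : ℕ) : ∫ u, thin A k u ∂M ≤ 1 := by
    calc ∫ u, thin A k u ∂M ≤ ∫ u, min 1 u / A ∂M := by
          apply integral_mono_ae (hthin_int k) (hM.div_const A)
          filter_upwards [hM0] with u hu using thin_le hA k hu.le
      _ = (∫ u, min 1 u ∂M) / A := integral_div _ _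
      _ ≤ 1 := by rw [div_le_one hA]; linarith
  let W : ℕ → Measure ℝ := fun k => M.withDensity fun u => ENNReal.ofReal (thin A k u)
  -- The missing mass sits at `0`, so the transform of `σ k` is `1 + ∫ thin A k u (exp (z u) - 1)
  -- ∂M`, and its `k`-th power tends to the exponential of the full integral.
  let σ : ℕ → Measure ℝ := fun k =>
    ENNReal.ofReal (1 - ∫ u, thin A k u ∂M) • Measure.dirac 0 + W k
  have hW (k : ℕ) : W k Set.univ = ENNReal.ofReal (∫ u, thin A k u ∂M) := by
    simp only [W]
    rw [withDensity_apply _ MeasurableSet.univ, Measure.restrict_univ,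
      ofReal_integral_eq_lintegral_ofReal (hthin_int k) (hthin_nn k)]
  have hWfin (k : ℕ) : IsFiniteMeasure (W k) := ⟨by rw [hW]; exact ENNReal.ofReal_lt_top⟩
  have hσp (k : ℕ) : IsProbabilityMeasure (σ k) := by
    constructor
    simp only [σ, Measure.add_apply, Measure.smul_apply, hW, smul_eq_mul, measure_univ, mul_one]
    rw [← ENNReal.ofReal_add (by linarith [hthin_le k]) (integral_nonneg_of_ae (hthin_nn k))]
    simp
  have hσ0 (k : ℕ) : ∀ᵐ x ∂(σ k), 0 ≤ x := by
    simp only [σ]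
    rw [ae_add_measure_iff]
    constructor
    · apply Measure.ae_smul_measure
      rw [ae_dirac_iff measurableSet_Ici]
    · exact (withDensity_absolutelyContinuous _ _).ae_le (hM0.mono fun u hu => hu.le)
  have hσint (k : ℕ) (z : ℂ) (hz : z.re ≤ 0) : ∫ x, Complex.exp (z * x) ∂(σ k)
      = 1 + ∫ u, (thin A k u : ℂ) * (Complex.exp (z * u) - 1) ∂M := by
    have hint := integrable_exp_of_ae_nonneg (hσ0 k) hz
    simp only [σ] at hint ⊢
    have h1 := integrable_add_measure.1 hint
    rw [integral_add_measure h1.1 h1.2, integral_smul_measure, integral_dirac,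
      ENNReal.toReal_ofReal (by linarith [hthin_le k])]
    simp only [W]
    rw [integral_withDensity_eq_integral_toReal_smul (measurable_thin A k).ennreal_ofReal
      (by simp)]
    have e1 : ∫ u, (ENNReal.ofReal (thin A k u)).toReal • Complex.exp (z * u) ∂M
        = ∫ u, ((thin A k u : ℂ) * (Complex.exp (z * u) - 1) + (thin A k u : ℂ)) ∂M := by
      apply integral_congr_ae
      filter_upwards [hthin_nn k] with u hu
      rw [ENNReal.toReal_ofReal hu, Complex.real_smul]
      ring
    rw [e1, integral_add, integral_complex_ofReal]
    · simp
    · refine ((hthin_int k).mul_const 2).mono'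
        (((Complex.measurable_ofReal.comp (measurable_thin A k)).mul
          (by fun_prop)).aestronglyMeasurable) ?_
      filter_upwards [hM0, hthin_nn k] with u hu hu'
      rw [norm_mul, Complex.norm_real, Real.norm_of_nonneg hu']
      apply mul_le_mul_of_nonneg_left _ hu'
      refine (norm_sub_le _ _).trans ?_
      have := norm_exp_le_one_of_re_nonpos hz hu.le
      simp only [norm_one]
      linarith
    · exact (hthin_int k).ofReal
  have hlim (z : ℂ) (hz : z.re ≤ 0) :
      Tendsto (fun k => ∫ x, Complex.exp (z * x) ∂(convPow (σ k) k)) atTop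
        (𝓝 (Complex.exp (∫ u, (Complex.exp (z * u) - 1) ∂M))) := by
    simp_rw [integral_exp_convPow _ (hσ0 _) hz, hσint _ z hz]
    apply Complex.tendsto_one_add_pow_exp_of_tendsto
    simp_rw [← integral_const_mul]
    refine tendsto_integral_of_dominated_convergence (fun u => (2 + 2 * ‖z‖) * min 1 u) ?_
      (hM.const_mul _) ?_ ?_
    · intro k
      exact (measurable_const.mul ((Complex.measurable_ofReal.comp (measurable_thin A k)).mul
          (by fun_prop))).aestronglyMeasurable
    · intro k
      filter_upwards [hM0] with u hu
      have h1 := norm_exp_sub_one_le_min hz hu.le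
      have h2 := mul_thin_le_one hA k hu.le
      have h3 : 0 ≤ k * thin A k u := mul_nonneg (by positivity) (thin_nonneg hA k hu.le)
      rw [← mul_assoc, norm_mul]
      have h4 : ‖(k : ℂ) * (thin A k u : ℂ)‖ = k * thin A k u := by
        rw [← Complex.ofReal_natCast, ← Complex.ofReal_mul, Complex.norm_real,
          Real.norm_of_nonneg h3]
      rw [h4]
      calc _ ≤ 1 * ‖Complex.exp (z * u) - 1‖ := by gcongr
        _ ≤ _ := by rwa [one_mul]
    · filter_upwards [hM0] with u hu
      have h1 : Tendsto (fun k : ℕ => (((k * thin A k u : ℝ)) : ℂ)) atTop (𝓝 ((1 : ℝ) : ℂ)) :=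
        (Complex.continuous_ofReal.tendsto _).comp (tendsto_mul_thin hu)
      have h2 := h1.mul_const (Complex.exp (z * u) - 1)
      simp only [Complex.ofReal_one, one_mul] at h2
      refine h2.congr fun k => ?_
      push_cast
      ring
  have hchar (μ : Measure ℝ) (ξ : ℝ) :
      charFun μ ξ = ∫ x, Complex.exp ((ξ * Complex.I) * x) ∂μ := by
    rw [charFun_apply_real]
    congr with x
    ring_nf
  have hre (ξ : ℝ) : ((ξ : ℂ) * Complex.I).re ≤ 0 := by simp
  -- Only imaginary `z` are needed for tightness. A limit along an ultrafilter is enough, since the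
  -- transforms themselves converge along the whole sequence.
  obtain ⟨U, η, hU, hη, hg⟩ := exists_tendsto_ultrafilter_of_tendsto_charFun
    (fun k => convPow (σ k) k) (fun k => inferInstance)
    (Φ := fun ξ => Complex.exp (∫ u, (Complex.exp ((ξ * Complex.I) * u) - 1) ∂M))
    (by
      apply Complex.continuous_exp.continuousAt.comp
      apply continuousAt_of_dominated (bound := fun u => (2 + 2 * 1) * min 1 u)
      · exact Eventually.of_forall fun ξ => by fun_prop
      · filter_upwards [Metric.ball_mem_nhds (0 : ℝ) one_pos] with ξ hξ
        filter_upwards [hM0] with u hu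
        refine (norm_exp_sub_one_le_min (hre ξ) hu.le).trans ?_
        have : 0 ≤ min 1 u := le_min zero_le_one hu.le
        have h1 : |ξ| ≤ 1 := by simpa using (mem_ball_zero_iff.1 hξ).le
        gcongr
        simpa using h1
      · exact hM.const_mul _
      · exact Eventually.of_forall fun u => by fun_prop)
    (fun ξ => by simpa only [hchar] using hlim _ (hre ξ))
  have hnn : ∀ᵐ x ∂η, 0 ≤ x := by
    -- A bounded continuous test function that is positive exactly on the negative reals: its
    -- integrals vanish along the sequence, hence in the limit.
    let g : ℝ →ᵇ ℂ := BoundedContinuousFunction.ofNormedAddCommGroup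
      (fun x : ℝ => ((min 1 (max (-x) 0) : ℝ) : ℂ)) (by fun_prop) 1 (by
        intro x
        rw [Complex.norm_real, Real.norm_of_nonneg (le_min zero_le_one (le_max_right _ _))]
        exact min_le_left _ _)
    have hg0 (k : ℕ) : ∫ x, g x ∂(convPow (σ k) k) = 0 := by
      apply integral_eq_zero_of_ae
      filter_upwards [ae_nonneg_convPow (σ k) (hσ0 k) k] with x hx
      simp [g, hx]
    have h1 : ∫ x, g x ∂η = 0 := by
      have := hg g
      simp only [hg0] at this
      exact (tendsto_nhds_unique this tendsto_const_nhds)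
    have h2 : ∫ x, min 1 (max (-x) 0) ∂η = 0 := by
      have h3 : ∫ x, g x ∂η = ((∫ x, min 1 (max (-x) 0) ∂η : ℝ) : ℂ) := by
        rw [← integral_complex_ofReal]
        rfl
      rw [h3] at h1
      exact_mod_cast h1
    rw [integral_eq_zero_iff_of_nonneg (f := fun x : ℝ => min 1 (max (-x) 0))
      (fun x => le_min zero_le_one (le_max_right _ _))] at h2
    · filter_upwards [h2] with x hx
      by_contra! hneg
      have : 0 < min 1 (max (-x) 0) := lt_min one_pos (lt_max_of_lt_left (by linarith))
      exact this.ne' hx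
    · refine Integrable.mono' (integrable_const (1 : ℝ)) (by fun_prop) ?_
      refine Eventually.of_forall fun x => ?_
      rw [Real.norm_of_nonneg (le_min zero_le_one (le_max_right _ _))]
      exact min_le_left _ _
  refine ⟨η, hη, hnn, fun z hz => ?_⟩
  -- Replacing `x` by `max x 0` makes the exponential bounded on `ℝ` for every `z` with `z.re ≤ 0`
  -- and changes nothing on the support, so one limit yields both Fourier and Laplace transforms.
  let g : ℝ →ᵇ ℂ := BoundedContinuousFunction.ofNormedAddCommGroup
    (fun x : ℝ => Complex.exp (z * (max x 0 : ℝ))) (by fun_prop) 1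
    (fun x => norm_exp_le_one_of_re_nonpos hz (le_max_right _ _))
  have hgint (μ : Measure ℝ) (hμ : ∀ᵐ x ∂μ, 0 ≤ x) :
      ∫ x, g x ∂μ = ∫ x, Complex.exp (z * x) ∂μ := by
    apply integral_congr_ae
    filter_upwards [hμ] with x hx
    simp [g, hx]
  have h1 := hg g
  rw [hgint η hnn] at h1
  simp only [hgint _ (ae_nonneg_convPow (σ _) (hσ0 _) _)] at h1
  exact tendsto_nhds_unique h1 ((hlim z hz).mono_left hU)

/-! ### Subordinators -/

/-- Existence of driftless subordinators with a given Lévy density. -/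
theorem exists_isSubordinator (m : ℝ → ℝ) (hm : Measurable m) (hm0 : ∀ u, 0 < u → 0 ≤ m u)
    (hint : IntegrableOn (fun u => min 1 u * m u) (Set.Ioi 0)) :
    ∃ η : ℝ≥0 → Measure ℝ, IsSubordinator η
      (fun l => ∫ u in Set.Ioi (0 : ℝ), (1 - Real.exp (-(l * u))) * m u) := by
  let M : Measure ℝ := (volume.restrict (Set.Ioi 0)).withDensity fun u => ENNReal.ofReal (m u)
  have hpos : ∀ᵐ u ∂(volume.restrict (Set.Ioi (0 : ℝ))), 0 < u :=
    ae_restrict_of_forall_mem measurableSet_Ioi fun u hu => hu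
  have hM0 : ∀ᵐ u ∂M, 0 < u := (withDensity_absolutelyContinuous _ _).ae_le hpos
  have hM : Integrable (fun u => min 1 u) M := by
    rw [integrable_withDensity_iff hm.ennreal_ofReal (by simp)]
    refine Integrable.congr hint ?_
    filter_upwards [hpos] with u hu
    rw [ENNReal.toReal_ofReal (hm0 u hu)]
  have hM0t (t : ℝ≥0) : ∀ᵐ u ∂(t • M), 0 < u := Measure.ae_smul_measure hM0 t
  have hMt (t : ℝ≥0) : Integrable (fun u => min 1 u) (t • M) := hM.smul_measure_nnreal
  choose η hη1 hη2 hη3 using fun t : ℝ≥0 => exists_infinitelyDivisible (t • M) (hM0t t) (hMt t)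
  refine ⟨η, isConvolutionSemigroup_of_charFun η hη1
    (fun ξ => -∫ u, (Complex.exp ((ξ * Complex.I) * u) - 1) ∂M) fun t ξ => ?_, fun t => ?_,
    fun t l hl => ?_⟩
  · rw [charFun_apply_real]
    have := hη3 t (ξ * Complex.I) (by simp)
    rw [integral_smul_nnreal_measure] at this
    convert this using 2
    · ext x; ring_nf
    · simp [NNReal.smul_def]
  · have := hη2 t
    rw [ae_iff] at this
    convert this using 2
    ext x
    simp
  · have h := hη3 t (-(l : ℂ)) (by simpa using hl.le)
    rw [integral_smul_nnreal_measure] at h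
    have e1 : ∫ x, Complex.exp (-(l : ℂ) * x) ∂(η t)
        = ((∫ s, Real.exp (-(l * s)) ∂(η t) : ℝ) : ℂ) := by
      rw [← integral_complex_ofReal]
      congr with x
      push_cast
      ring_nf
    have e2 : ∫ u, (Complex.exp (-(l : ℂ) * u) - 1) ∂M
        = ((-∫ u in Set.Ioi (0 : ℝ), (1 - Real.exp (-(l * u))) * m u : ℝ) : ℂ) := by
      simp only [M]
      rw [integral_withDensity_eq_integral_toReal_smul hm.ennreal_ofReal (by simp),
        ← integral_neg, ← integral_complex_ofReal]
      apply integral_congr_ae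
      filter_upwards [hpos] with u hu
      rw [ENNReal.toReal_ofReal (hm0 u hu), Complex.real_smul]
      push_cast
      ring_nf
    rw [e1, e2, NNReal.smul_def, ← Complex.coe_smul, smul_eq_mul, ← Complex.ofReal_mul,
      ← Complex.ofReal_exp] at h
    have h' := Complex.ofReal_injective h
    rw [h', mul_neg]

/-! ### Gaussian subordination and the Lévy measure of the subordinate process -/

section Subordination

variable {V : Type*} [NormedAddCommGroup V] [InnerProductSpace ℝ V]

/-- The transition density at time `2 u` of the standard Brownian motion. -/
noncomputable def heatKernel (V : Type*) [NormedAddCommGroup V] [InnerProductSpace ℝ V]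
    (u : ℝ) (x : V) : ℝ :=
  (4 * Real.pi * u) ^ (-(Module.finrank ℝ V / 2 : ℝ)) * Real.exp (-(‖x‖ ^ 2 / (4 * u)))

theorem heatKernel_nonneg {u : ℝ} (hu : 0 < u) (x : V) : 0 ≤ heatKernel V u x := by
  unfold heatKernel
  positivity

/-- The density of the Lévy measure of a subordinate Brownian motion. -/
noncomputable def jumpDensity (V : Type*) [NormedAddCommGroup V] [InnerProductSpace ℝ V]
    (m : ℝ → ℝ) (x : V) : ℝ :=
  ∫ u in Set.Ioi (0 : ℝ), heatKernel V u x * m u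

theorem jumpDensity_neg (m : ℝ → ℝ) (x : V) : jumpDensity V m (-x) = jumpDensity V m x := by
  simp [jumpDensity, heatKernel]

theorem jumpDensity_nonneg {m : ℝ → ℝ} (hm0 : ∀ u, 0 < u → 0 ≤ m u) (x : V) :
    0 ≤ jumpDensity V m x :=
  setIntegral_nonneg measurableSet_Ioi fun u hu => mul_nonneg (heatKernel_nonneg hu x) (hm0 u hu)

variable [MeasurableSpace V] [BorelSpace V]

theorem measurable_heatKernel : Measurable fun z : ℝ × V => heatKernel V z.1 z.2 := by
  unfold heatKernel
  fun_prop

theorem measurable_jumpDensity {m : ℝ → ℝ} (hm : Measurable m) :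
    Measurable (jumpDensity V m) := by
  have h : Measurable fun z : V × ℝ => heatKernel V z.2 z.1 * m z.2 :=
    (measurable_heatKernel.comp measurable_swap).mul (hm.comp measurable_snd)
  exact (h.stronglyMeasurable.integral_prod_right (ν := volume.restrict (Set.Ioi 0))).measurable

variable [FiniteDimensional ℝ V]

/-- Given `s`, the vector `√(2s) G` has characteristic function `exp (-s ‖ξ‖²)`; the factor `2`
cancels the Gaussian `1/2`. -/
theorem charFun_subordinated_stdGaussian (η : Measure ℝ) [IsProbabilityMeasure η]
    (hη : η (Set.Iio 0) = 0) (ξ : V) :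
    charFun ((η.prod (stdGaussian V)).map fun z => √(2 * z.1) • z.2) ξ
      = ((∫ s, Real.exp (-(‖ξ‖ ^ 2 * s)) ∂η : ℝ) : ℂ) := by
  have hmeas : Measurable fun z : ℝ × V => √(2 * z.1) • z.2 := by fun_prop
  rw [charFun_apply, integral_map hmeas.aemeasurable (by fun_prop), integral_prod,
    ← integral_complex_ofReal]
  · apply integral_congr_ae
    have h0 : ∀ᵐ s ∂η, 0 ≤ s := by
      rw [ae_iff]
      convert hη using 2
      ext; simp
    filter_upwards [h0] with s hs
    have h1 := charFun_stdGaussian (√(2 * s) • ξ)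
    rw [charFun_apply] at h1
    simp only [real_inner_smul_left, real_inner_smul_right] at h1 ⊢
    rw [h1, norm_smul, Real.norm_of_nonneg (Real.sqrt_nonneg _)]
    push_cast
    congr 1
    rw [mul_pow, ← Complex.ofReal_pow, Real.sq_sqrt (by positivity)]
    push_cast
    ring
  · refine Integrable.mono' (integrable_const (1 : ℝ)) (by fun_prop) ?_
    refine Eventually.of_forall fun z => ?_
    rw [Complex.norm_exp_ofReal_mul_I]

/-- Brownian motion subordinated by the driftless subordinator with completely monotone Lévy
density `m`. -/
theorem exists_isCompleteSubordinateBrownianMotion (m : ℝ → ℝ) (hm : Measurable m)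
    (hcm : IsCompletelyMonotone m) (hint : IntegrableOn (fun u => min 1 u * m u) (Set.Ioi 0)) :
    ∃ q : ℝ≥0 → Measure V, IsCompleteSubordinateBrownianMotion q ∧ IsConvolutionSemigroup q ∧
      ∀ (t : ℝ≥0) (ξ : V), charFun (q t) ξ = Complex.exp (-((t : ℝ) *
        ∫ u in Set.Ioi (0 : ℝ), (1 - Real.exp (-(‖ξ‖ ^ 2 * u))) * m u : ℝ)) := by
  obtain ⟨η, hη⟩ := exists_isSubordinator m hm
    (fun u hu => by simpa using hcm.2 0 u hu) hint
  have hprob := hη.semigroup.isProbabilityMeasure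
  have hchar (t : ℝ≥0) (ξ : V) :
      charFun (((η t).prod (stdGaussian V)).map fun z => √(2 * z.1) • z.2) ξ
        = Complex.exp (-((t : ℝ) *
          ∫ u in Set.Ioi (0 : ℝ), (1 - Real.exp (-(‖ξ‖ ^ 2 * u))) * m u : ℝ)) := by
    rw [charFun_subordinated_stdGaussian _ (hη.support t), ← Complex.ofReal_neg,
      ← Complex.ofReal_exp]
    congr 1
    -- The Laplace identity is available only for positive arguments, so `ξ = 0` is separate.
    rcases eq_or_ne ξ 0 with rfl | hξ
    · simp
    · exact hη.laplace_eq t (‖ξ‖ ^ 2) (by positivity)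
  refine ⟨fun t => ((η t).prod (stdGaussian V)).map fun z => √(2 * z.1) • z.2,
    ⟨η, _, ⟨0, 0, m, le_rfl, le_rfl, hcm, hint, fun l _ => by simp⟩, hη, fun t => rfl⟩,
    isConvolutionSemigroup_of_charFun _ (fun t => ?_) (fun ξ =>
      ((∫ u in Set.Ioi (0 : ℝ), (1 - Real.exp (-(‖ξ‖ ^ 2 * u))) * m u : ℝ) : ℂ))
      (fun t ξ => ?_), hchar⟩
  · have hmeas : Measurable fun z : ℝ × V => √(2 * z.1) • z.2 := by fun_prop
    exact Measure.isProbabilityMeasure_map hmeas.aemeasurable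
  · rw [hchar]
    push_cast
    rfl

theorem integral_cexp_mul_heatKernel {u : ℝ} (hu : 0 < u) (ξ : V) :
    ∫ x, Complex.exp (⟪ξ, x⟫ * Complex.I) * (heatKernel V u x : ℂ)
      = Complex.exp (-(‖ξ‖ ^ 2 * u : ℝ)) := by
  have hb : 0 < ((1 / (4 * u) : ℝ) : ℂ).re := by
    rw [Complex.ofReal_re]; positivity
  have h := GaussianFourier.integral_cexp_neg_mul_sq_norm_add hb Complex.I ξ
  have hpos : 0 < 4 * Real.pi * u := by positivity
  have e1 (x : V) : Complex.exp (⟪ξ, x⟫ * Complex.I) * (heatKernel V u x : ℂ)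
      = (((4 * Real.pi * u) ^ (-(Module.finrank ℝ V / 2 : ℝ)) : ℝ) : ℂ) *
        Complex.exp (-((1 / (4 * u) : ℝ) : ℂ) * ‖x‖ ^ 2 + Complex.I * ⟪ξ, x⟫) := by
    unfold heatKernel
    rw [Complex.ofReal_mul, Complex.ofReal_exp, mul_left_comm, ← Complex.exp_add]
    congr 2
    push_cast
    ring
  simp_rw [e1]
  rw [integral_const_mul, h]
  have e2 : ((Real.pi : ℂ) / ((1 / (4 * u) : ℝ) : ℂ)) ^ (Module.finrank ℝ V / 2 : ℂ)
      = (((4 * Real.pi * u) ^ (Module.finrank ℝ V / 2 : ℝ) : ℝ) : ℂ) := by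
    rw [Complex.ofReal_cpow hpos.le]
    congr 1
    · push_cast; field_simp
    · push_cast; rfl
  rw [e2, ← mul_assoc, ← Complex.ofReal_mul, ← Real.rpow_add hpos]
  simp only [neg_add_cancel, Real.rpow_zero, Complex.ofReal_one, one_mul, Complex.I_sq]
  congr 1
  have : (u : ℂ) ≠ 0 := by exact_mod_cast hu.ne'
  push_cast
  field_simp

/-- The Fourier identity at `ξ = 0` gives integral `1`, whereas a non-integrable function has
integral `0` by convention. -/
theorem integrable_heatKernel {u : ℝ} (hu : 0 < u) : Integrable (heatKernel V u) := by
  have h := integral_cexp_mul_heatKernel hu (0 : V)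
  simp only [inner_zero_left, Complex.ofReal_zero, zero_mul, Complex.exp_zero, one_mul] at h
  rw [integral_complex_ofReal] at h
  by_contra hni
  rw [integral_undef hni] at h
  simp at h

theorem integral_one_sub_cos_mul_heatKernel {u : ℝ} (hu : 0 < u) (ξ : V) :
    ∫ x, (1 - Real.cos ⟪ξ, x⟫) * heatKernel V u x = 1 - Real.exp (-(‖ξ‖ ^ 2 * u)) := by
  have hint := integrable_heatKernel (V := V) hu
  have hk : ∫ x, heatKernel V u x = 1 := by
    have h := integral_cexp_mul_heatKernel hu (0 : V)
    simp only [inner_zero_left, Complex.ofReal_zero, zero_mul, Complex.exp_zero, one_mul] at h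
    rw [integral_complex_ofReal] at h
    simpa using h
  have hci : Integrable fun x => Real.cos ⟪ξ, x⟫ * heatKernel V u x := by
    refine hint.bdd_mul (c := 1) (by fun_prop) ?_
    exact Eventually.of_forall fun x => Real.abs_cos_le_one _
  have hc : ∫ x, Real.cos ⟪ξ, x⟫ * heatKernel V u x = Real.exp (-(‖ξ‖ ^ 2 * u)) := by
    have hi : Integrable fun x => Complex.exp (⟪ξ, x⟫ * Complex.I) * (heatKernel V u x : ℂ) := by
      refine hint.ofReal.bdd_mul (c := 1) (by fun_prop) ?_
      exact Eventually.of_forall fun x => (Complex.norm_exp_ofReal_mul_I _).le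
    have h := congrArg Complex.re (integral_cexp_mul_heatKernel hu ξ)
    rw [← Complex.ofReal_neg, ← Complex.ofReal_exp, Complex.ofReal_re] at h
    rw [← h]
    have := integral_re hi
    simp only [RCLike.re_to_complex] at this
    rw [← this]
    congr with x
    rw [Complex.re_mul_ofReal, Complex.exp_ofReal_mul_I_re]
  simp_rw [sub_mul, one_mul]
  rw [integral_sub hint hci, hk, hc]

/-- Tonelli: for fixed `u` the heat kernel integrates `1 - cos⟪ξ, x⟫` to `1 - exp (-‖ξ‖² u)`.
Nontriviality of `V` makes the origin, where the `u`-integral may diverge, a null set. -/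
theorem integral_one_sub_cos_jumpDensity [Nontrivial V] {m : ℝ → ℝ} (hm : Measurable m)
    (hm0 : ∀ u, 0 < u → 0 ≤ m u)
    (hint : ∀ x : V, x ≠ 0 → IntegrableOn (fun u => heatKernel V u x * m u) (Set.Ioi 0)) (ξ : V) :
    ∫ x, (1 - Real.cos ⟪ξ, x⟫)
        ∂((volume : Measure V).withDensity fun x => ENNReal.ofReal (jumpDensity V m x))
      = ∫ u in Set.Ioi (0 : ℝ), (1 - Real.exp (-(‖ξ‖ ^ 2 * u))) * m u := by
  have hcos (x : V) : 0 ≤ 1 - Real.cos ⟪ξ, x⟫ := by linarith [Real.cos_le_one ⟪ξ, x⟫]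
  have hne : ∀ᵐ x : V, x ≠ 0 := by
    rw [ae_iff]
    simp
  have hpos : ∀ᵐ u ∂(volume.restrict (Set.Ioi (0 : ℝ))), 0 < u :=
    ae_restrict_of_forall_mem measurableSet_Ioi fun u hu => hu
  have hmj := measurable_jumpDensity (V := V) hm
  rw [integral_eq_lintegral_of_nonneg_ae (Eventually.of_forall hcos) (by fun_prop),
    integral_eq_lintegral_of_nonneg_ae]
  · congr 1
    rw [lintegral_withDensity_eq_lintegral_mul _ hmj.ennreal_ofReal (by fun_prop)]
    have e1 : ∀ᵐ x : V, ((fun x => ENNReal.ofReal (jumpDensity V m x)) *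
        fun x => ENNReal.ofReal (1 - Real.cos ⟪ξ, x⟫)) x
        = ∫⁻ u in Set.Ioi (0 : ℝ), ENNReal.ofReal ((1 - Real.cos ⟪ξ, x⟫) * heatKernel V u x)
          * ENNReal.ofReal (m u) := by
      filter_upwards [hne] with x hx
      rw [Pi.mul_apply, jumpDensity, ofReal_integral_eq_lintegral_ofReal (hint x hx),
        mul_comm, ← lintegral_const_mul]
      · apply lintegral_congr_ae
        filter_upwards [hpos] with u hu
        rw [ENNReal.ofReal_mul (hcos x), ENNReal.ofReal_mul (heatKernel_nonneg hu x), mul_assoc]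
      · exact ((measurable_heatKernel.comp measurable_prodMk_right).mul hm).ennreal_ofReal
      · filter_upwards [hpos] with u hu using mul_nonneg (heatKernel_nonneg hu x) (hm0 u hu)
    rw [lintegral_congr_ae e1, lintegral_lintegral_swap]
    · apply lintegral_congr_ae
      filter_upwards [hpos] with u hu
      rw [lintegral_mul_const, ← ofReal_integral_eq_lintegral_ofReal,
        integral_one_sub_cos_mul_heatKernel hu, ENNReal.ofReal_mul]
      · simp only [sub_nonneg, Real.exp_le_one_iff, Left.neg_nonpos_iff]
        positivity
      · refine (integrable_heatKernel hu).bdd_mul (c := 2) (by fun_prop) ?_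
        refine Eventually.of_forall fun x => ?_
        rw [Real.norm_of_nonneg (hcos x)]
        linarith [Real.neg_one_le_cos ⟪ξ, x⟫]
      · exact Eventually.of_forall fun x => mul_nonneg (hcos x) (heatKernel_nonneg hu x)
      · exact (Measurable.mul (by fun_prop)
          (measurable_heatKernel.comp measurable_prodMk_left)).ennreal_ofReal
    · refine Measurable.aemeasurable (Measurable.mul (Measurable.ennreal_ofReal
        (Measurable.mul (by fun_prop) ?_)) (hm.comp measurable_snd).ennreal_ofReal)
      exact measurable_heatKernel.comp measurable_swap
  · filter_upwards [hpos] with u hu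
    refine mul_nonneg ?_ (hm0 u hu)
    simp only [sub_nonneg, Real.exp_le_one_iff, Left.neg_nonpos_iff]
    positivity
  · exact (Measurable.mul (by fun_prop) hm).aestronglyMeasurable

/-- The subordinate Brownian motion is a symmetric pure-jump Lévy process. -/
theorem exists_isSymmetricPureJumpLevy [Nontrivial V] (m : ℝ → ℝ) (hm : Measurable m)
    (hcm : IsCompletelyMonotone m) (hint : IntegrableOn (fun u => min 1 u * m u) (Set.Ioi 0))
    (hker : ∀ x : V, x ≠ 0 → IntegrableOn (fun u => heatKernel V u x * m u) (Set.Ioi 0))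
    (hlevy : ∫⁻ x : V, ENNReal.ofReal (min (‖x‖ ^ 2) 1 * jumpDensity V m x) < ⊤) :
    ∃ (q : ℝ≥0 → Measure V) (ν : Measure V) (ψ : V → ℝ),
      IsCompleteSubordinateBrownianMotion q ∧ IsSymmetricPureJumpLevy q ν ψ ∧
      HasDensity ν (jumpDensity V m) := by
  have hm0 : ∀ u, 0 < u → 0 ≤ m u := fun u hu => by simpa using hcm.2 0 u hu
  have hmj := measurable_jumpDensity (V := V) hm
  obtain ⟨q, hq1, hq2, hq3⟩ := exists_isCompleteSubordinateBrownianMotion (V := V) m hm hcm hint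
  refine ⟨q, volume.withDensity fun x => ENNReal.ofReal (jumpDensity V m x), _, hq1,
    ⟨hq2, ⟨?_, ?_⟩, ?_, fun ξ => (integral_one_sub_cos_jumpDensity hm hm0 hker ξ).symm, hq3⟩,
    ⟨hmj, jumpDensity_nonneg hm0, rfl⟩⟩
  · exact withDensity_absolutelyContinuous _ _ (by simp)
  · rw [lintegral_withDensity_eq_lintegral_mul _ hmj.ennreal_ofReal (by fun_prop)]
    refine lt_of_eq_of_lt (lintegral_congr fun x => ?_) hlevy
    rw [Pi.mul_apply, mul_comm, ENNReal.ofReal_mul (by positivity)]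
  · ext s hs
    rw [Measure.map_apply measurable_neg hs, withDensity_apply _ hs,
      withDensity_apply _ (measurable_neg hs)]
    have := (Measure.measurePreserving_neg (volume : Measure V)).setLIntegral_comp_preimage hs
      hmj.ennreal_ofReal
    simpa only [jumpDensity_neg] using this

end Subordination

/-! ### Laplace transforms as completely monotone Lévy densities -/

section LaplaceTransform

/-- The Laplace transform of the measure with density `F` on `(0, ∞)`. -/
noncomputable def laplaceTransform (F : ℝ → ℝ) (u : ℝ) : ℝ :=
  ∫ s in Set.Ioi (0 : ℝ), Real.exp (-(u * s)) * F s

theorem measurable_laplaceTransform {F : ℝ → ℝ} (hF : Measurable F) :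
    Measurable (laplaceTransform F) := by
  have h : Measurable fun z : ℝ × ℝ => Real.exp (-(z.1 * z.2)) * F z.2 := by fun_prop
  exact (h.stronglyMeasurable.integral_prod_right (ν := volume.restrict (Set.Ioi 0))).measurable

theorem integral_exp_neg_mul_Ioi {u : ℝ} (hu : 0 < u) :
    ∫ s in Set.Ioi (0 : ℝ), Real.exp (-(u * s)) = 1 / u := by
  have h := Real.integral_rpow_mul_exp_neg_mul_Ioi one_pos hu
  simpa using h

theorem integrableOn_exp_neg_mul_Ioi {u : ℝ} (hu : 0 < u) :
    IntegrableOn (fun s => Real.exp (-(u * s))) (Set.Ioi (0 : ℝ)) := by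
  apply Integrable.of_integral_ne_zero
  rw [integral_exp_neg_mul_Ioi hu]
  positivity

theorem integral_mul_exp_neg_mul_Ioi {u : ℝ} (hu : 0 < u) :
    ∫ s in Set.Ioi (0 : ℝ), s * Real.exp (-(u * s)) = (1 / u) ^ 2 := by
  have h := Real.integral_rpow_mul_exp_neg_mul_Ioi (a := 2) two_pos hu
  norm_num at h
  simpa using h

theorem integrableOn_mul_exp_neg_mul_Ioi {u : ℝ} (hu : 0 < u) :
    IntegrableOn (fun s => s * Real.exp (-(u * s))) (Set.Ioi (0 : ℝ)) := by
  apply Integrable.of_integral_ne_zero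
  rw [integral_mul_exp_neg_mul_Ioi hu]
  positivity

/-- The transform is the moment generating function of `-s` under `F s ds`, hence analytic on `(0,
∞)`; its derivatives carry a factor `(-s) ^ k`, whose sign cancels `(-1) ^ k`. -/
theorem isCompletelyMonotone_laplaceTransform {F : ℝ → ℝ} (hF : Measurable F)
    (hF0 : ∀ s, 0 < s → 0 ≤ F s)
    (hint : ∀ u, 0 < u → IntegrableOn (fun s => Real.exp (-(u * s)) * F s) (Set.Ioi 0)) :
    IsCompletelyMonotone (laplaceTransform F) := by
  let μ : Measure ℝ := (volume.restrict (Set.Ioi 0)).withDensity fun s => ENNReal.ofReal (F s)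
  have hpos : ∀ᵐ s ∂(volume.restrict (Set.Ioi (0 : ℝ))), 0 < s :=
    ae_restrict_of_forall_mem measurableSet_Ioi fun u hu => hu
  have hμpos : ∀ᵐ s ∂μ, 0 < s := (withDensity_absolutelyContinuous _ _).ae_le hpos
  have hmgf : laplaceTransform F = mgf (fun s => -s) μ := by
    ext u
    simp only [laplaceTransform, mgf, μ]
    rw [integral_withDensity_eq_integral_toReal_smul hF.ennreal_ofReal (by simp)]
    apply integral_congr_ae
    filter_upwards [hpos] with s hs
    rw [ENNReal.toReal_ofReal (hF0 s hs), smul_eq_mul, mul_comm, mul_neg]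
  have hsub : Set.Ioi (0 : ℝ) ⊆ interior (integrableExpSet (fun s => -s) μ) := by
    rw [isOpen_Ioi.subset_interior_iff]
    intro u hu
    simp only [integrableExpSet, Set.mem_ofPred_eq, μ]
    rw [integrable_withDensity_iff hF.ennreal_ofReal (by simp)]
    refine Integrable.congr (hint u hu) ?_
    filter_upwards [hpos] with s hs
    rw [ENNReal.toReal_ofReal (hF0 s hs), mul_neg]
  rw [hmgf]
  refine ⟨((analyticOnNhd_mgf.mono hsub).contDiffOn isOpen_Ioi.uniqueDiffOn).of_le le_top,
    fun k u hu => ?_⟩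
  rw [iteratedDeriv_mgf (hsub hu), ← integral_const_mul]
  apply integral_nonneg_of_ae
  filter_upwards [hμpos] with s hs
  rw [← mul_assoc, ← mul_pow, neg_mul_neg, one_mul]
  simp only [Pi.zero_apply]
  positivity

variable {F : ℝ → ℝ} {C : ℝ}

theorem integrableOn_exp_mul_of_linear_growth (hF : Measurable F) (hF0 : ∀ s, 0 < s → 0 ≤ F s)
    (hC : ∀ s t, 0 < s → 0 < t → F s ≤ F t * (1 + C * (s / t))) {u : ℝ} (hu : 0 < u) :
    IntegrableOn (fun s => Real.exp (-(u * s)) * F s) (Set.Ioi 0) := by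
  have h1 : IntegrableOn (fun s => F 1 * Real.exp (-(u * s)) +
      F 1 * C * (s * Real.exp (-(u * s)))) (Set.Ioi (0 : ℝ)) :=
    ((integrableOn_exp_neg_mul_Ioi hu).const_mul _).add
      ((integrableOn_mul_exp_neg_mul_Ioi hu).const_mul _)
  refine Integrable.mono' h1 (Measurable.aestronglyMeasurable (by fun_prop)) ?_
  refine ae_restrict_of_forall_mem measurableSet_Ioi fun s (hs : 0 < s) => ?_
  rw [Real.norm_of_nonneg (mul_nonneg (Real.exp_pos _).le (hF0 s hs))]
  have := mul_le_mul_of_nonneg_left (hC s 1 hs one_pos) (Real.exp_pos (-(u * s))).le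
  rw [div_one] at this
  linarith

/-- The growth condition with `t = 1/u` compares `F s` with `F (1/u) (1 + C u s)`, and the
exponential moments of orders `0` and `1` are explicit. -/
theorem laplaceTransform_le (hF : Measurable F) (hF0 : ∀ s, 0 < s → 0 ≤ F s)
    (hC : ∀ s t, 0 < s → 0 < t → F s ≤ F t * (1 + C * (s / t))) {u : ℝ} (hu : 0 < u) :
    laplaceTransform F u ≤ (1 + C) * (F (1 / u) / u) := by
  have h1 : IntegrableOn (fun s => F (1 / u) * Real.exp (-(u * s)) +
      F (1 / u) * C * u * (s * Real.exp (-(u * s)))) (Set.Ioi (0 : ℝ)) :=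
    ((integrableOn_exp_neg_mul_Ioi hu).const_mul _).add
      ((integrableOn_mul_exp_neg_mul_Ioi hu).const_mul _)
  calc laplaceTransform F u ≤ ∫ s in Set.Ioi (0 : ℝ), (F (1 / u) * Real.exp (-(u * s)) +
      F (1 / u) * C * u * (s * Real.exp (-(u * s)))) := by
        refine setIntegral_mono_on (integrableOn_exp_mul_of_linear_growth hF hF0 hC hu) h1
          measurableSet_Ioi fun s hs => ?_
        have := mul_le_mul_of_nonneg_left (hC s (1 / u) hs (by positivity))
          (Real.exp_pos (-(u * s))).le
        rw [div_div_eq_mul_div, div_one] at this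
        linarith
    _ = (1 + C) * (F (1 / u) / u) := by
        rw [integral_add ((integrableOn_exp_neg_mul_Ioi hu).const_mul _)
          ((integrableOn_mul_exp_neg_mul_Ioi hu).const_mul _), integral_const_mul,
          integral_const_mul, integral_exp_neg_mul_Ioi hu, integral_mul_exp_neg_mul_Ioi hu]
        field_simp

/-- By monotonicity `F s ≥ F (1/u)` on `s > 1/u`, and that range alone gives the factor `exp (-1)`.
-/
theorem le_laplaceTransform (hF : Monotone F) (hF0 : ∀ s, 0 < s → 0 ≤ F s)
    (hC : ∀ s t, 0 < s → 0 < t → F s ≤ F t * (1 + C * (s / t))) {u : ℝ} (hu : 0 < u) :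
    Real.exp (-1) * (F (1 / u) / u) ≤ laplaceTransform F u := by
  have hint := integrableOn_exp_mul_of_linear_growth hF.measurable hF0 hC hu
  have hsub : Set.Ioi (1 / u) ⊆ Set.Ioi (0 : ℝ) := Set.Ioi_subset_Ioi (by positivity)
  have hval : ∫ s in Set.Ioi (1 / u), Real.exp (-(u * s)) = Real.exp (-1) / u := by
    have := integral_exp_mul_Ioi (a := -u) (by linarith) (1 / u)
    simp only [neg_mul] at this
    rw [this, mul_one_div_cancel hu.ne', neg_div_neg_eq]
  calc Real.exp (-1) * (F (1 / u) / u)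
      = ∫ s in Set.Ioi (1 / u), F (1 / u) * Real.exp (-(u * s)) := by
        rw [integral_const_mul, hval]; ring
    _ ≤ ∫ s in Set.Ioi (1 / u), Real.exp (-(u * s)) * F s := by
        refine setIntegral_mono_on (((integrableOn_exp_neg_mul_Ioi hu).mono_set hsub).const_mul _)
          (hint.mono_set hsub) measurableSet_Ioi fun s hs => ?_
        rw [mul_comm]
        exact mul_le_mul_of_nonneg_left (hF (le_of_lt hs)) (Real.exp_pos _).le
    _ ≤ laplaceTransform F u := by
        refine setIntegral_mono_set hint ?_ (LE.le.eventuallyLE hsub)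
        exact ae_restrict_of_forall_mem measurableSet_Ioi fun s hs =>
          mul_nonneg (Real.exp_pos _).le (hF0 s hs)

/-- By `laplaceTransform_le`, the integrand is at most a multiple of `u ^ (-b)` with `b < 1` on `(0,
1]`, and of `u ^ (-a - 1)` with `a > 0` beyond `1`. -/
theorem integrableOn_min_mul_laplaceTransform (hF : Measurable F) (hF0 : ∀ s, 0 < s → 0 ≤ F s)
    (hC0 : 0 ≤ C) (hC : ∀ s t, 0 < s → 0 < t → F s ≤ F t * (1 + C * (s / t)))
    {a b A B : ℝ} (ha : 0 < a) (hb : b < 1)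
    (hA : ∀ u, 1 < u → F (1 / u) ≤ A * u ^ (-a))
    (hB : ∀ u, 0 < u → u ≤ 1 → F (1 / u) ≤ B * u ^ (-b)) :
    IntegrableOn (fun u => min 1 u * laplaceTransform F u) (Set.Ioi 0) := by
  have hm := measurable_laplaceTransform hF
  have hm0 : ∀ u, 0 ≤ laplaceTransform F u := fun u =>
    setIntegral_nonneg measurableSet_Ioi fun s hs => mul_nonneg (Real.exp_pos _).le (hF0 s hs)
  have hmeas : AEStronglyMeasurable (fun u => min 1 u * laplaceTransform F u) volume :=
    Measurable.aestronglyMeasurable (by fun_prop)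
  rw [← Set.Ioc_union_Ioi_eq_Ioi zero_le_one]
  refine IntegrableOn.union ?_ ?_
  · have h1 : IntegrableOn (fun u : ℝ => (1 + C) * (B * u ^ (-b))) (Set.Ioc 0 1) := by
      refine Integrable.const_mul (Integrable.const_mul ?_ _) _
      exact (intervalIntegrable_iff_integrableOn_Ioc_of_le zero_le_one).1
        (intervalIntegral.intervalIntegrable_rpow' (by linarith))
    refine Integrable.mono' h1 hmeas.restrict ?_
    refine ae_restrict_of_forall_mem measurableSet_Ioc fun u ⟨hu, hu1⟩ => ?_
    rw [min_eq_right hu1, Real.norm_of_nonneg (mul_nonneg hu.le (hm0 u))]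
    calc u * laplaceTransform F u ≤ u * ((1 + C) * (F (1 / u) / u)) := by
          gcongr; exact laplaceTransform_le hF hF0 hC hu
      _ = (1 + C) * F (1 / u) := by field_simp
      _ ≤ _ := by gcongr; exact hB u hu hu1
  · have h1 : IntegrableOn (fun u : ℝ => (1 + C) * (A * u ^ (-a - 1))) (Set.Ioi 1) :=
      Integrable.const_mul (Integrable.const_mul
        (integrableOn_Ioi_rpow_of_lt (by linarith) one_pos) _) _
    refine Integrable.mono' h1 hmeas.restrict ?_
    refine ae_restrict_of_forall_mem measurableSet_Ioi fun u (hu : 1 < u) => ?_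
    have hu0 : 0 < u := by linarith
    rw [min_eq_left hu.le, one_mul, Real.norm_of_nonneg (hm0 u)]
    calc laplaceTransform F u ≤ (1 + C) * (F (1 / u) / u) := laplaceTransform_le hF hF0 hC hu0
      _ ≤ (1 + C) * (A * u ^ (-a) / u) := by gcongr; exact hA u hu
      _ = _ := by rw [Real.rpow_sub_one hu0.ne']; ring

end LaplaceTransform

/-! ### Two-sided bounds for the jump density -/

section JumpDensityBounds

variable {V : Type*} [NormedAddCommGroup V] [InnerProductSpace ℝ V]

/-- The integrand that dominates the jump density after rescaling. -/
noncomputable def scaledHeatIntegrand (D C w : ℝ) : ℝ :=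
  (4 * Real.pi * w) ^ (-(D / 2)) * Real.exp (-(1 / (4 * w))) * (1 / w * (1 + C * (1 / w)))

/-- One term `y ^ k / k!` of the series for `exp y` at `y = 1 / (4 w)`, with a natural `k ≥ a`. -/
theorem exists_exp_neg_inv_le (a : ℝ) :
    ∃ K : ℝ, 0 < K ∧ ∀ w : ℝ, 0 < w → w ≤ 1 → Real.exp (-(1 / (4 * w))) ≤ K * w ^ a := by
  obtain ⟨k, hk⟩ := exists_nat_ge a
  refine ⟨k.factorial * 4 ^ k, by positivity, fun w hw hw1 => ?_⟩
  have h := Real.pow_div_factorial_le_exp (1 / (4 * w)) (by positivity) k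
  rw [Real.exp_neg]
  calc (Real.exp (1 / (4 * w)))⁻¹ ≤ ((1 / (4 * w)) ^ k / k.factorial)⁻¹ := by gcongr
    _ = k.factorial * 4 ^ k * w ^ (k : ℝ) := by
      rw [Real.rpow_natCast, inv_div, one_div, inv_pow, mul_pow, div_inv_eq_mul, mul_assoc]
    _ ≤ k.factorial * 4 ^ k * w ^ a := by
      gcongr ?_ * ?_
      exact Real.rpow_le_rpow_of_exponent_ge hw hw1 hk

theorem integrableOn_scaledHeatIntegrand {D C : ℝ} (hD : 0 < D) (hC : 0 ≤ C) :
    IntegrableOn (scaledHeatIntegrand D C) (Set.Ioi 0) := by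
  have hmeas : Measurable (scaledHeatIntegrand D C) := by
    unfold scaledHeatIntegrand; fun_prop
  have hnn (w : ℝ) (hw : 0 < w) : 0 ≤ scaledHeatIntegrand D C w := by
    unfold scaledHeatIntegrand; positivity
  have hpi : 0 < 4 * Real.pi := by positivity
  rw [← Set.Ioc_union_Ioi_eq_Ioi zero_le_one]
  refine IntegrableOn.union ?_ ?_
  -- The exponent `D / 2 + 2` cancels `w ^ (-D / 2)` from the kernel and `w ^ (-2)` from the last
  -- factor, which leaves a constant.
  · obtain ⟨K, hK, hexp⟩ := exists_exp_neg_inv_le (D / 2 + 2)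
    refine Integrable.mono' (g := fun _ => (4 * Real.pi) ^ (-(D / 2)) * K * (1 + C))
      (integrableOn_const measure_Ioc_lt_top.ne) hmeas.aestronglyMeasurable ?_
    refine ae_restrict_of_forall_mem measurableSet_Ioc fun w ⟨hw, hw1⟩ => ?_
    rw [Real.norm_of_nonneg (hnn w hw)]
    have e1 : 1 / w * (1 + C * (1 / w)) ≤ (1 + C) * w ^ (-2 : ℝ) := by
      rw [Real.rpow_neg hw.le, Real.rpow_two]
      rw [← sub_nonneg]
      have : (1 + C) * (w ^ 2)⁻¹ - 1 / w * (1 + C * (1 / w)) = (1 - w) / w ^ 2 := by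
        field_simp
        ring
      rw [this]
      have : 0 ≤ 1 - w := by linarith
      positivity
    unfold scaledHeatIntegrand
    calc _ ≤ (4 * Real.pi * w) ^ (-(D / 2)) * (K * w ^ (D / 2 + 2)) *
          ((1 + C) * w ^ (-2 : ℝ)) := by
          gcongr
          exact hexp w hw hw1
      _ = (4 * Real.pi) ^ (-(D / 2)) * K * (1 + C) *
          (w ^ (-(D / 2)) * w ^ (D / 2 + 2) * w ^ (-2 : ℝ)) := by
          rw [Real.mul_rpow hpi.le hw.le]; ring
      _ = _ := by
          rw [← Real.rpow_add hw, ← Real.rpow_add hw]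
          have : -(D / 2) + (D / 2 + 2) + -2 = 0 := by ring
          rw [this, Real.rpow_zero, mul_one]
  · have h1 : IntegrableOn (fun w : ℝ => (4 * Real.pi) ^ (-(D / 2)) * (1 + C) *
        w ^ (-(D / 2) - 1)) (Set.Ioi 1) :=
      Integrable.const_mul (integrableOn_Ioi_rpow_of_lt (by linarith) one_pos) _
    refine Integrable.mono' h1 hmeas.aestronglyMeasurable ?_
    refine ae_restrict_of_forall_mem measurableSet_Ioi fun w (hw1 : 1 < w) => ?_
    have hw : 0 < w := by linarith
    rw [Real.norm_of_nonneg (hnn w hw)]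
    unfold scaledHeatIntegrand
    have e1 : Real.exp (-(1 / (4 * w))) ≤ 1 := by
      rw [Real.exp_le_one_iff]
      have : 0 ≤ 1 / (4 * w) := by positivity
      linarith
    have e2 : 1 / w ≤ 1 := by rw [div_le_one hw]; exact hw1.le
    calc _ ≤ (4 * Real.pi * w) ^ (-(D / 2)) * 1 * (1 / w * (1 + C * 1)) := by gcongr
      _ = _ := by
          rw [Real.mul_rpow hpi.le hw.le, Real.rpow_sub_one hw.ne']
          ring

variable {F : ℝ → ℝ} {C : ℝ}

/-- Substitute `u = ‖x‖² w`: the growth condition moves `F (1/u)` to `F (1/‖x‖²)` at the cost of `1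
+ C / w`, and the kernel scales by `‖x‖ ^ (-d)`. All dependence on `x` is then outside one fixed
function of `w`. -/
theorem heatKernel_mul_laplaceTransform_le (hF : Measurable F) (hF0 : ∀ s, 0 < s → 0 ≤ F s)
    (hC0 : 0 ≤ C) (hC : ∀ s t, 0 < s → 0 < t → F s ≤ F t * (1 + C * (s / t)))
    {x : V} (hx : x ≠ 0) {u : ℝ} (hu : 0 < u) :
    heatKernel V u x * laplaceTransform F u ≤
      (1 + C) * (F (1 / ‖x‖ ^ 2) / ‖x‖ ^ (Module.finrank ℝ V + 2)) *
        scaledHeatIntegrand (Module.finrank ℝ V) C ((1 / ‖x‖ ^ 2) * u) := by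
  have hr : 0 < ‖x‖ := norm_pos_iff.2 hx
  have hpi : 0 < 4 * Real.pi := by positivity
  set r := ‖x‖
  set D := Module.finrank ℝ V
  have h1 : laplaceTransform F u ≤
      (1 + C) * (F (1 / r ^ 2) * (1 + C * ((1 / u) / (1 / r ^ 2))) / u) := by
    refine (laplaceTransform_le hF hF0 hC hu).trans ?_
    gcongr
    exact hC _ _ (by positivity) (by positivity)
  refine (mul_le_mul_of_nonneg_left h1 (heatKernel_nonneg hu x)).trans (le_of_eq ?_)
  have e1 : (4 * Real.pi * (1 / r ^ 2 * u)) ^ (-((D : ℝ) / 2))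
      = (4 * Real.pi * u) ^ (-((D : ℝ) / 2)) * r ^ D := by
    have : (1 / r ^ 2 : ℝ) = r ^ (-2 : ℝ) := by
      rw [Real.rpow_neg hr.le, Real.rpow_two, one_div]
    rw [this, show 4 * Real.pi * (r ^ (-2 : ℝ) * u) = (4 * Real.pi * u) * r ^ (-2 : ℝ) by ring,
      Real.mul_rpow (by positivity) (by positivity), ← Real.rpow_mul hr.le, ← Real.rpow_natCast]
    congr 2
    ring
  unfold heatKernel scaledHeatIntegrand
  rw [e1, pow_add]
  have e2 : 1 / (4 * (1 / r ^ 2 * u)) = r ^ 2 / (4 * u) := by field_simp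
  rw [e2]
  change (4 * Real.pi * u) ^ (-((D : ℝ) / 2)) * Real.exp (-(r ^ 2 / (4 * u))) * _ = _
  field_simp

variable [Nontrivial V] [FiniteDimensional ℝ V]

theorem integrableOn_heatKernel_mul_laplaceTransform [MeasurableSpace V] [BorelSpace V]
    (hF : Measurable F) (hF0 : ∀ s, 0 < s → 0 ≤ F s)
    (hC0 : 0 ≤ C) (hC : ∀ s t, 0 < s → 0 < t → F s ≤ F t * (1 + C * (s / t)))
    {x : V} (hx : x ≠ 0) :
    IntegrableOn (fun u => heatKernel V u x * laplaceTransform F u) (Set.Ioi 0) := by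
  have hr : 0 < ‖x‖ := norm_pos_iff.2 hx
  have hD : (0 : ℝ) < Module.finrank ℝ V := by exact_mod_cast Module.finrank_pos
  have hm0 : ∀ u, 0 ≤ laplaceTransform F u := fun u =>
    setIntegral_nonneg measurableSet_Ioi fun s hs => mul_nonneg (Real.exp_pos _).le (hF0 s hs)
  have h1 := (integrableOn_Ioi_comp_mul_left_iff
    (scaledHeatIntegrand (Module.finrank ℝ V) C) 0 (a := 1 / ‖x‖ ^ 2) (by positivity)).2
    (by rw [mul_zero]; exact integrableOn_scaledHeatIntegrand hD hC0)
  refine Integrable.mono' (h1.const_mul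
    ((1 + C) * (F (1 / ‖x‖ ^ 2) / ‖x‖ ^ (Module.finrank ℝ V + 2)))) ?_ ?_
  · exact (((measurable_heatKernel (V := V)).comp measurable_prodMk_right).mul
      (measurable_laplaceTransform hF)).aestronglyMeasurable
  · refine ae_restrict_of_forall_mem measurableSet_Ioi fun u hu => ?_
    rw [Real.norm_of_nonneg (mul_nonneg (heatKernel_nonneg hu x) (hm0 u))]
    exact heatKernel_mul_laplaceTransform_le hF hF0 hC0 hC hx hu

theorem exists_jumpDensity_le (hF : Measurable F) (hF0 : ∀ s, 0 < s → 0 ≤ F s)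
    (hC0 : 0 ≤ C) (hC : ∀ s t, 0 < s → 0 < t → F s ≤ F t * (1 + C * (s / t))) :
    ∃ K : ℝ, 0 < K ∧ ∀ x : V, x ≠ 0 →
      jumpDensity V (laplaceTransform F) x ≤
        K * (F (1 / ‖x‖ ^ 2) / ‖x‖ ^ Module.finrank ℝ V) := by
  borelize V
  have hD : (0 : ℝ) < Module.finrank ℝ V := by exact_mod_cast Module.finrank_pos
  set J := ∫ w in Set.Ioi (0 : ℝ), scaledHeatIntegrand (Module.finrank ℝ V) C w with hJ
  have hJ0 : 0 ≤ J := setIntegral_nonneg measurableSet_Ioi fun w hw => by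
    have : 0 < w := hw
    unfold scaledHeatIntegrand; positivity
  -- `J + 1` instead of `J` only ensures a positive constant.
  refine ⟨(1 + C) * (J + 1), by positivity, fun x hx => ?_⟩
  have hr : 0 < ‖x‖ := norm_pos_iff.2 hx
  have h1 := (integrableOn_Ioi_comp_mul_left_iff
    (scaledHeatIntegrand (Module.finrank ℝ V) C) 0 (a := 1 / ‖x‖ ^ 2) (by positivity)).2
    (by rw [mul_zero]; exact integrableOn_scaledHeatIntegrand hD hC0)
  have h2 := integral_comp_mul_left_Ioi (scaledHeatIntegrand (Module.finrank ℝ V) C) 0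
    (b := 1 / ‖x‖ ^ 2) (by positivity)
  rw [mul_zero, ← hJ, smul_eq_mul] at h2
  have hF1 : 0 ≤ F (1 / ‖x‖ ^ 2) := hF0 _ (by positivity)
  calc jumpDensity V (laplaceTransform F) x
      ≤ ∫ u in Set.Ioi (0 : ℝ),
        (1 + C) * (F (1 / ‖x‖ ^ 2) / ‖x‖ ^ (Module.finrank ℝ V + 2)) *
        scaledHeatIntegrand (Module.finrank ℝ V) C ((1 / ‖x‖ ^ 2) * u) :=
        setIntegral_mono_on (integrableOn_heatKernel_mul_laplaceTransform hF hF0 hC0 hC hx)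
          (h1.const_mul _) measurableSet_Ioi fun u hu =>
            heatKernel_mul_laplaceTransform_le hF hF0 hC0 hC hx hu
    _ = (1 + C) * J * (F (1 / ‖x‖ ^ 2) / ‖x‖ ^ Module.finrank ℝ V) := by
        rw [integral_const_mul, h2, pow_add]
        field_simp
    _ ≤ _ := by gcongr; linarith

theorem exists_le_jumpDensity (hF : Monotone F) (hF0 : ∀ s, 0 < s → 0 ≤ F s)
    (hC0 : 0 ≤ C) (hC : ∀ s t, 0 < s → 0 < t → F s ≤ F t * (1 + C * (s / t))) :
    ∃ K : ℝ, 0 < K ∧ ∀ x : V, x ≠ 0 →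
      K * (F (1 / ‖x‖ ^ 2) / ‖x‖ ^ Module.finrank ℝ V) ≤
        jumpDensity V (laplaceTransform F) x := by
  borelize V
  have hpi : 0 < 4 * Real.pi := by positivity
  set D := Module.finrank ℝ V
  -- Only `u` in `(r² / 2, r²]` is used: its length gives the `1 / 2`, the Gaussian factor there is
  -- at least `exp (-1/2)`, and `exp (-1)` comes from `le_laplaceTransform`.
  refine ⟨(4 * Real.pi) ^ (-((D : ℝ) / 2)) * Real.exp (-(1 / 2)) * Real.exp (-1) / 2,
    by positivity, fun x hx => ?_⟩
  have hr : 0 < ‖x‖ := norm_pos_iff.2 hx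
  set r := ‖x‖
  have hF1 : 0 ≤ F (1 / r ^ 2) := hF0 _ (by positivity)
  have hint := integrableOn_heatKernel_mul_laplaceTransform hF.measurable hF0 hC0 hC hx
  have hsub : Set.Ioc (r ^ 2 / 2) (r ^ 2) ⊆ Set.Ioi (0 : ℝ) := fun u hu =>
    lt_trans (by positivity) hu.1
  have hm0 : ∀ u, 0 ≤ laplaceTransform F u := fun u =>
    setIntegral_nonneg measurableSet_Ioi fun s hs => mul_nonneg (Real.exp_pos _).le (hF0 s hs)
  have e1 : (4 * Real.pi * r ^ 2) ^ (-((D : ℝ) / 2))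
      = (4 * Real.pi) ^ (-((D : ℝ) / 2)) / r ^ D := by
    rw [Real.mul_rpow hpi.le (by positivity), ← Real.rpow_natCast r 2, ← Real.rpow_mul hr.le,
      div_eq_mul_inv _ (r ^ D), ← Real.rpow_natCast r D, ← Real.rpow_neg hr.le]
    congr 2
    push_cast
    ring
  calc _ = ∫ u in Set.Ioc (r ^ 2 / 2) (r ^ 2), (4 * Real.pi * r ^ 2) ^ (-((D : ℝ) / 2)) *
          Real.exp (-(1 / 2)) * (Real.exp (-1) * (F (1 / r ^ 2) / r ^ 2)) := by
        rw [setIntegral_const, e1, measureReal_def, Real.volume_Ioc,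
          ENNReal.toReal_ofReal (by nlinarith), smul_eq_mul]
        field_simp
        ring
    _ ≤ ∫ u in Set.Ioc (r ^ 2 / 2) (r ^ 2), heatKernel V u x * laplaceTransform F u := by
        refine setIntegral_mono_on (integrableOn_const measure_Ioc_lt_top.ne)
          (hint.mono_set hsub) measurableSet_Ioc fun u hu => ?_
        have hu0 : 0 < u := hsub hu
        have a1 : Real.exp (-1) * (F (1 / r ^ 2) / r ^ 2) ≤ laplaceTransform F u := by
          refine le_trans ?_ (le_laplaceTransform hF hF0 hC hu0)
          have : F (1 / r ^ 2) ≤ F (1 / u) := hF (one_div_le_one_div_of_le hu0 hu.2)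
          have : 0 ≤ F (1 / u) := hF0 _ (by positivity)
          gcongr
          exact hu.2
        have a2 : (4 * Real.pi * r ^ 2) ^ (-((D : ℝ) / 2)) * Real.exp (-(1 / 2))
            ≤ heatKernel V u x := by
          unfold heatKernel
          have b1 : (4 * Real.pi * r ^ 2) ^ (-((D : ℝ) / 2)) ≤
              (4 * Real.pi * u) ^ (-((D : ℝ) / 2)) := by
            apply Real.rpow_le_rpow_of_nonpos (by positivity)
            · gcongr; exact hu.2
            · have : (0 : ℝ) ≤ D := by positivity
              linarith
          have b2 : r ^ 2 / (4 * u) ≤ 1 / 2 := by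
            rw [div_le_iff₀ (by positivity)]
            linarith [hu.1]
          gcongr
        exact mul_le_mul a2 a1 (by positivity) (heatKernel_nonneg hu0 x)
    _ ≤ _ := by
        refine setIntegral_mono_set hint ?_ (LE.le.eventuallyLE hsub)
        exact ae_restrict_of_forall_mem measurableSet_Ioi fun u hu =>
          mul_nonneg (heatKernel_nonneg hu x) (hm0 u)

end JumpDensityBounds

/-! ### The characteristic exponent and the radial profile -/

section ExponentBounds

/-- The radial profile that dominates `min (r ^ 2) 1 * n` in the scaling regime. -/
noncomputable def radialMajorant (D a b r : ℝ) : ℝ :=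
  if r ≤ 1 then r ^ (2 - b - D) else r ^ (-a - D)

variable {V : Type*} [NormedAddCommGroup V] [InnerProductSpace ℝ V]

/-- In polar coordinates the profile becomes `r ^ (1 - b)` near `0` and `r ^ (-a - 1)` at infinity.
-/
theorem integrable_radialMajorant [FiniteDimensional ℝ V] [MeasurableSpace V] [BorelSpace V]
    [Nontrivial V] {a b : ℝ} (ha : 0 < a) (hb : b < 2) :
    Integrable fun x : V => radialMajorant (Module.finrank ℝ V) a b ‖x‖ := by
  rw [integrable_fun_norm_addHaar (volume : Measure V)
    (f := fun r => radialMajorant (Module.finrank ℝ V) a b r)]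
  have hD : 1 ≤ Module.finrank ℝ V := Module.finrank_pos
  set D := Module.finrank ℝ V
  have hcast : ((D - 1 : ℕ) : ℝ) = D - 1 := by rw [Nat.cast_sub hD, Nat.cast_one]
  have hpow (y : ℝ) : y ^ (D - 1) = y ^ ((D : ℝ) - 1) := by
    rw [← hcast, Real.rpow_natCast]
  rw [← Set.Ioc_union_Ioi_eq_Ioi zero_le_one]
  refine IntegrableOn.union ?_ ?_
  · have h1 : IntegrableOn (fun y : ℝ => y ^ (1 - b)) (Set.Ioc 0 1) :=
      (intervalIntegrable_iff_integrableOn_Ioc_of_le zero_le_one).1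
        (intervalIntegral.intervalIntegrable_rpow' (by linarith))
    refine h1.congr_fun (fun y ⟨hy, hy1⟩ => ?_) measurableSet_Ioc
    simp only [radialMajorant, if_pos hy1, smul_eq_mul]
    rw [hpow, ← Real.rpow_add hy]
    ring_nf
  · have h1 : IntegrableOn (fun y : ℝ => y ^ (-a - 1)) (Set.Ioi 1) :=
      integrableOn_Ioi_rpow_of_lt (by linarith) one_pos
    refine h1.congr_fun (fun y (hy : 1 < y) => ?_) measurableSet_Ioi
    simp only [radialMajorant, if_neg hy.not_ge, smul_eq_mul]
    rw [hpow, ← Real.rpow_add (by linarith)]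
    ring_nf

theorem radialMajorant_nonneg {D a b r : ℝ} (hr : 0 ≤ r) : 0 ≤ radialMajorant D a b r := by
  unfold radialMajorant
  split_ifs <;> positivity

/-- If `R r ≤ 1`, upper scaling goes from `R` up to `1 / r`; otherwise lower scaling goes from `1 /
r > θ` up to `R`. The weight `w` is left free so that the bound serves both `1 - cos` with `R = ‖ξ‖`
and the Lévy condition with `R = 1`. -/
theorem mul_density_le_radialMajorant {θ a b cl Cu K : ℝ} {f : ℝ → ℝ} (hcl : 0 < cl)
    (hCu : 0 ≤ Cu) (hK : 0 ≤ K) (hf_pos : ∀ r, 0 < r → 0 < f r)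
    (hlower : WLSC a θ cl f) (hupper : WUSC b θ Cu f) {D : ℕ} {R r w y : ℝ} (hR : 0 < R)
    (hRθ : θ < R) (hr : 0 < r) (hrθ : θ * r < 1) (hw0 : 0 ≤ w) (hw : w ≤ 2 * min ((R * r) ^ 2) 1)
    (hy : y ≤ K * (f (1 / r) / r ^ D)) :
    w * y ≤ K * (2 * (Cu + cl⁻¹)) * (f R * (R ^ D * radialMajorant D a b (R * r))) := by
  have hRr : 0 < R * r := by positivity
  have hfR := hf_pos R hR
  have hfr := hf_pos (1 / r) (by positivity)
  have hcl' : 0 < cl⁻¹ := by positivity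
  have key : w * (f (1 / r) / r ^ D) ≤
      2 * (Cu + cl⁻¹) * (f R * (R ^ D * radialMajorant D a b (R * r))) := by
    unfold radialMajorant
    split_ifs with h
    · have h1 : f (1 / r) ≤ Cu * (1 / (R * r)) ^ b * f R := by
        have := hupper (1 / (R * r)) R (by rw [le_div_iff₀ hRr]; linarith) hRθ
        rwa [show 1 / (R * r) * R = 1 / r by field_simp] at this
      have e : (R * r) ^ (2 - b - (D : ℝ)) = (R * r) ^ 2 * (1 / (R * r)) ^ b / (R * r) ^ D := by
        rw [Real.rpow_sub hRr, Real.rpow_sub hRr, Real.rpow_two, Real.rpow_natCast, one_div,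
          Real.inv_rpow hRr.le]
        ring
      calc w * (f (1 / r) / r ^ D)
          ≤ (2 * (R * r) ^ 2) * (Cu * (1 / (R * r)) ^ b * f R / r ^ D) := by
            gcongr
            exact hw.trans (by gcongr; exact min_le_left _ _)
        _ = 2 * Cu * (f R * (R ^ D * (R * r) ^ (2 - b - (D : ℝ)))) := by
            rw [e, mul_pow R r D]
            field_simp
        _ ≤ _ := by gcongr; linarith
    · push Not at h
      have hθr : θ < 1 / r := by rwa [lt_div_iff₀ hr]
      have h1 : f (1 / r) ≤ cl⁻¹ * (R * r) ^ (-a) * f R := by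
        have := hlower (R * r) (1 / r) h.le hθr
        rw [show R * r * (1 / r) = R by field_simp] at this
        rw [Real.rpow_neg hRr.le]
        have hp : 0 < (R * r) ^ a := by positivity
        calc f (1 / r) = cl⁻¹ * ((R * r) ^ a)⁻¹ * (cl * (R * r) ^ a * f (1 / r)) := by field_simp
          _ ≤ _ := by gcongr
      have e : (R * r) ^ (-a - (D : ℝ)) = (R * r) ^ (-a) / (R * r) ^ D := by
        rw [Real.rpow_sub hRr, Real.rpow_natCast]
      calc w * (f (1 / r) / r ^ D)
          ≤ 2 * (cl⁻¹ * (R * r) ^ (-a) * f R / r ^ D) := by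
            gcongr
            exact hw.trans (by nlinarith [min_le_right ((R * r) ^ 2) 1])
        _ = 2 * cl⁻¹ * (f R * (R ^ D * (R * r) ^ (-a - (D : ℝ)))) := by
            rw [e, mul_pow R r D]
            field_simp
        _ ≤ _ := by gcongr; linarith
  calc w * y ≤ w * (K * (f (1 / r) / r ^ D)) := by gcongr
    _ = K * (w * (f (1 / r) / r ^ D)) := by ring
    _ ≤ K * (2 * (Cu + cl⁻¹) * (f R * (R ^ D * radialMajorant D a b (R * r)))) := by gcongr
    _ = _ := by ring

theorem one_sub_cos_le_two_mul_min (s : ℝ) : 1 - Real.cos s ≤ 2 * min (s ^ 2) 1 := by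
  have h1 := Real.one_sub_sq_div_two_le_cos (x := s)
  have h2 := Real.neg_one_le_cos s
  rcases le_total (s ^ 2) 1 with h | h
  · rw [min_eq_left h]; nlinarith [sq_nonneg s]
  · rw [min_eq_right h]; linarith

theorem one_sub_cos_inner_le (ξ x : V) :
    1 - Real.cos ⟪ξ, x⟫ ≤ 2 * min ((‖ξ‖ * ‖x‖) ^ 2) 1 := by
  refine (one_sub_cos_le_two_mul_min _).trans ?_
  have h : ⟪ξ, x⟫ ^ 2 ≤ (‖ξ‖ * ‖x‖) ^ 2 := sq_le_sq.2 (by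
    rw [abs_of_nonneg (by positivity : 0 ≤ ‖ξ‖ * ‖x‖)]; exact abs_real_inner_le_norm ξ x)
  gcongr

variable [FiniteDimensional ℝ V] [MeasurableSpace V] [BorelSpace V]

theorem integrable_mul_of_le_min {ν : Measure V} {n : V → ℝ} (hν : IsLevyMeasure ν)
    (hn : HasDensity ν n) {w : V → ℝ} (hw : Measurable w) {B : ℝ} (hw0 : ∀ x, 0 ≤ w x)
    (hwB : ∀ x, w x ≤ B * min (‖x‖ ^ 2) 1) : Integrable fun x => w x * n x := by
  have hmin : Integrable (fun x : V => min (‖x‖ ^ 2) 1) ν := by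
    refine ⟨by fun_prop, ?_⟩
    rw [hasFiniteIntegral_iff_ofReal (Eventually.of_forall fun x => by positivity)]
    exact hν.lintegral_lt_top
  have hwi : Integrable w ν := by
    refine (hmin.const_mul B).mono' hw.aestronglyMeasurable (Eventually.of_forall fun x => ?_)
    rw [Real.norm_of_nonneg (hw0 x)]
    exact hwB x
  rw [hn.eq_withDensity, integrable_withDensity_iff hn.measurable.ennreal_ofReal (by simp)] at hwi
  refine hwi.congr (Eventually.of_forall fun x => ?_)
  simp only [ENNReal.toReal_ofReal (hn.nonneg x)]

theorem integrable_one_sub_cos_mul {ν : Measure V} {n : V → ℝ} (hν : IsLevyMeasure ν)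
    (hn : HasDensity ν n) (ξ : V) : Integrable fun x => (1 - Real.cos ⟪ξ, x⟫) * n x := by
  refine integrable_mul_of_le_min hν hn (B := 2 * (‖ξ‖ ^ 2 + 1)) (by fun_prop)
    (fun x => by linarith [Real.cos_le_one ⟪ξ, x⟫]) fun x => ?_
  refine (one_sub_cos_inner_le ξ x).trans ?_
  rw [mul_assoc]
  gcongr
  rw [mul_pow]
  have h0 := sq_nonneg ‖x‖
  have h1 := sq_nonneg ‖ξ‖
  rcases le_total (‖x‖ ^ 2) 1 with h | h
  · rw [min_eq_left h]
    exact (min_le_left _ _).trans (by nlinarith)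
  · rw [min_eq_right h]
    exact (min_le_right _ _).trans (by nlinarith)

theorem exponent_eq_integral_density {ν : Measure V} {n : V → ℝ} (hn : HasDensity ν n) (ξ : V) :
    ∫ x, (1 - Real.cos ⟪ξ, x⟫) ∂ν = ∫ x, (1 - Real.cos ⟪ξ, x⟫) * n x := by
  rw [hn.eq_withDensity, integral_withDensity_eq_integral_toReal_smul
    hn.measurable.ennreal_ofReal (by simp)]
  congr with x
  rw [ENNReal.toReal_ofReal (hn.nonneg x), smul_eq_mul, mul_comm]

theorem integral_comp_radialMajorant [Nontrivial V] (a b : ℝ) {R : ℝ} (hR : 0 < R) :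
    ∫ x : V, R ^ Module.finrank ℝ V * radialMajorant (Module.finrank ℝ V) a b (R * ‖x‖)
      = ∫ x : V, radialMajorant (Module.finrank ℝ V) a b ‖x‖ := by
  have h := Measure.integral_comp_smul (volume : Measure V)
    (fun x : V => radialMajorant (Module.finrank ℝ V) a b ‖x‖) R
  simp only [norm_smul, Real.norm_of_nonneg hR.le, smul_eq_mul] at h
  rw [integral_const_mul, h, abs_of_pos (by positivity)]
  field_simp

theorem integrable_comp_radialMajorant [Nontrivial V] {a b : ℝ} (ha : 0 < a) (hb : b < 2) {R : ℝ}
    (hR : 0 < R) :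
    Integrable fun x : V =>
      R ^ Module.finrank ℝ V * radialMajorant (Module.finrank ℝ V) a b (R * ‖x‖) := by
  have h := (integrable_radialMajorant (V := V) ha hb).comp_smul hR.ne'
  simp only [norm_smul, Real.norm_of_nonneg hR.le] at h
  exact h.const_mul _

/-- Upper bound for the characteristic exponent. -/
theorem exists_exponent_le [Nontrivial V] {ν : Measure V} {n : V → ℝ} (hν : IsLevyMeasure ν)
    (hn : HasDensity ν n) {θ a b cl Cu K : ℝ} {f : ℝ → ℝ} (hθ : 0 ≤ θ) (ha : 0 < a) (hb : b < 2)
    (hcl : 0 < cl) (hCu : 0 ≤ Cu) (hK : 0 ≤ K) (hf_mono : MonotoneOn f (Set.Ioi 0))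
    (hf_pos : ∀ r, 0 < r → 0 < f r) (hlower : WLSC a θ cl f) (hupper : WUSC b θ Cu f)
    (hf : ∀ x : V, x ≠ 0 → θ * ‖x‖ < 1 → n x ≤ K * (f (1 / ‖x‖) / ‖x‖ ^ Module.finrank ℝ V)) :
    ∃ C : ℝ, 0 < C ∧ ∀ ξ : V, θ < ‖ξ‖ → ∫ x, (1 - Real.cos ⟪ξ, x⟫) ∂ν ≤ C * f ‖ξ‖ := by
  let S : Set V := {x | 1 ≤ θ * ‖x‖}
  have hS : MeasurableSet S := measurableSet_le measurable_const (by fun_prop)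
  -- Jumps of size at least `1/θ`: none if `θ = 0`; otherwise their bounded contribution is compared
  -- with `f θ ≤ f ‖ξ‖`.
  obtain ⟨M, hM0, hM⟩ : ∃ M : ℝ, 0 ≤ M ∧
      ∀ ξ : V, θ < ‖ξ‖ → ∫ x, S.indicator (fun x => 2 * n x) x ≤ M * f ‖ξ‖ := by
    rcases hθ.eq_or_lt with rfl | hθ0
    · refine ⟨0, le_rfl, fun ξ _ => le_of_eq ?_⟩
      have : S = ∅ := by ext x; simp [S]
      simp [this]
    · have h0 : 0 ≤ ∫ x, S.indicator (fun x => 2 * n x) x :=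
        integral_nonneg fun x => Set.indicator_nonneg
          (fun x _ => mul_nonneg zero_le_two (hn.nonneg x)) x
      have hfθ := hf_pos θ hθ0
      refine ⟨(∫ x, S.indicator (fun x => 2 * n x) x) / f θ, by positivity, fun ξ hξ => ?_⟩
      have : f θ ≤ f ‖ξ‖ := hf_mono hθ0 (hθ0.trans hξ) hξ.le
      rw [div_mul_eq_mul_div, le_div_iff₀ hfθ]
      gcongr
  have hSint : Integrable (S.indicator fun x => 2 * n x) := by
    have h1 := integrable_mul_of_le_min hν hn (w := S.indicator fun _ => 2)
      (B := 2 * (θ ^ 2 + 1)) (measurable_const.indicator hS)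
      (fun x => Set.indicator_nonneg (fun _ _ => zero_le_two) x) (fun x => by
        have hm : 0 ≤ min (‖x‖ ^ 2) 1 := by positivity
        by_cases hx : x ∈ S
        · rw [Set.indicator_of_mem hx, mul_assoc]
          have hx' : 1 ≤ θ * ‖x‖ := hx
          have h2 : 1 ≤ (θ ^ 2 + 1) * min (‖x‖ ^ 2) 1 := by
            rcases le_total (‖x‖ ^ 2) 1 with h | h
            · rw [min_eq_left h]
              nlinarith [sq_nonneg ‖x‖]
            · rw [min_eq_right h]
              nlinarith [sq_nonneg θ]
          linarith
        · rw [Set.indicator_of_notMem hx]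
          positivity)
    refine h1.congr (Eventually.of_forall fun x => ?_)
    by_cases hx : x ∈ S <;> simp [hx]
  set J := ∫ x : V, radialMajorant (Module.finrank ℝ V) a b ‖x‖
  have hJ : 0 ≤ J := integral_nonneg fun x => radialMajorant_nonneg (norm_nonneg x)
  have hcl' : 0 < cl⁻¹ := by positivity
  refine ⟨K * (2 * (Cu + cl⁻¹)) * J + M + 1, by positivity, fun ξ hξ => ?_⟩
  have hξ0 : 0 < ‖ξ‖ := hθ.trans_lt hξ
  have hfξ := hf_pos _ hξ0
  have hRi := (integrable_comp_radialMajorant (V := V) ha hb hξ0).const_mul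
    (K * (2 * (Cu + cl⁻¹)) * f ‖ξ‖)
  rw [exponent_eq_integral_density hn]
  calc ∫ x, (1 - Real.cos ⟪ξ, x⟫) * n x
      ≤ ∫ x, (K * (2 * (Cu + cl⁻¹)) * f ‖ξ‖ * (‖ξ‖ ^ Module.finrank ℝ V *
          radialMajorant (Module.finrank ℝ V) a b (‖ξ‖ * ‖x‖)) +
          S.indicator (fun x => 2 * n x) x) := by
        refine integral_mono_ae (integrable_one_sub_cos_mul hν hn ξ) (hRi.add hSint) ?_
        have hne : ∀ᵐ x : V, x ≠ 0 := by
          rw [ae_iff]; simp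
        filter_upwards [hne] with x hx
        have hx0 : 0 < ‖x‖ := norm_pos_iff.2 hx
        have hcos : 0 ≤ 1 - Real.cos ⟪ξ, x⟫ := by linarith [Real.cos_le_one ⟪ξ, x⟫]
        by_cases hxS : x ∈ S
        · rw [Set.indicator_of_mem hxS]
          have h1 : (1 - Real.cos ⟪ξ, x⟫) * n x ≤ 2 * n x :=
            mul_le_mul_of_nonneg_right (by linarith [Real.neg_one_le_cos ⟪ξ, x⟫]) (hn.nonneg x)
          have h2 : 0 ≤ radialMajorant (Module.finrank ℝ V) a b (‖ξ‖ * ‖x‖) :=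
            radialMajorant_nonneg (by positivity)
          have h3 : 0 ≤ K * (2 * (Cu + cl⁻¹)) * f ‖ξ‖ * (‖ξ‖ ^ Module.finrank ℝ V *
            radialMajorant (Module.finrank ℝ V) a b (‖ξ‖ * ‖x‖)) := by positivity
          linarith
        · rw [Set.indicator_of_notMem hxS, add_zero]
          have hxS' : θ * ‖x‖ < 1 := not_le.1 hxS
          rw [mul_assoc]
          exact mul_density_le_radialMajorant hcl hCu hK hf_pos hlower hupper hξ0 hξ hx0 hxS' hcos
            (one_sub_cos_inner_le ξ x) (hf x hx hxS')
    _ = K * (2 * (Cu + cl⁻¹)) * f ‖ξ‖ * J + ∫ x, S.indicator (fun x => 2 * n x) x := by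
        rw [integral_add hRi hSint, integral_const_mul, integral_comp_radialMajorant a b hξ0]
    _ ≤ K * (2 * (Cu + cl⁻¹)) * f ‖ξ‖ * J + M * f ‖ξ‖ := by gcongr; exact hM ξ hξ
    _ ≤ _ := by linarith

/-- Lower bound for the characteristic exponent. -/
theorem exists_le_exponent {ν : Measure V} {n : V → ℝ} (hν : IsLevyMeasure ν)
    (hn : HasDensity ν n) {θ k : ℝ} {f : ℝ → ℝ} (hθ : 0 ≤ θ) (hk : 0 < k)
    (hf_mono : MonotoneOn f (Set.Ioi 0)) (hf_pos : ∀ r, 0 < r → 0 < f r)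
    (hf : ∀ x : V, x ≠ 0 → θ * ‖x‖ < 1 → k * (f (1 / ‖x‖) / ‖x‖ ^ Module.finrank ℝ V) ≤ n x) :
    ∃ C : ℝ, 0 < C ∧ ∀ ξ : V, θ < ‖ξ‖ → C * f ‖ξ‖ ≤ ∫ x, (1 - Real.cos ⟪ξ, x⟫) ∂ν := by
  set v := (volume : Measure V).real (Metric.ball 0 1)
  have hv : 0 < v := by
    refine ENNReal.toReal_pos (Metric.measure_ball_pos _ _ one_pos).ne' measure_ball_lt_top.ne
  set D := Module.finrank ℝ V
  set κ := 1 - Real.cos (1 / 4)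
  have hκ : 0 < κ := by
    have : Real.cos (1 / 4) < Real.cos 0 :=
      Real.cos_lt_cos_of_nonneg_of_le_pi le_rfl (by linarith [Real.pi_gt_three]) (by norm_num)
    rw [Real.cos_zero] at this
    simp only [κ]; linarith
  refine ⟨κ * k * ((1 / 4) ^ D * v), by positivity, fun ξ hξ => ?_⟩
  have hR : 0 < ‖ξ‖ := hθ.trans_lt hξ
  set R := ‖ξ‖ with hRdef
  have hfR := hf_pos R hR
  -- Centre chosen with `⟪ξ, x₀⟫ = 1/2`; on the ball of radius `1 / (4 R)` the inner product stays
  -- in `[1/4, 3/4]` and `‖x‖ ≤ 1/R`, so `κ` bounds `1 - cos` and monotonicity bounds `n` from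
  -- below.
  set x₀ : V := (1 / (2 * R ^ 2)) • ξ
  set B := Metric.ball x₀ (1 / (4 * R))
  have hx₀ : ‖x₀‖ = 1 / (2 * R) := by
    simp only [x₀]
    rw [norm_smul, Real.norm_of_nonneg (by positivity), ← hRdef]
    field_simp
  have hin₀ : ⟪ξ, x₀⟫ = 1 / 2 := by
    simp only [x₀]
    rw [real_inner_smul_right, real_inner_self_eq_norm_sq, ← hRdef]
    field_simp
  have hvol : (volume : Measure V).real B = (1 / 4) ^ D * v / R ^ D := by
    simp only [B, v, measureReal_def]
    rw [Measure.addHaar_ball_of_pos _ _ (by positivity), ENNReal.toReal_mul,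
      ENNReal.toReal_ofReal (by positivity), ← div_div, div_pow]
    ring
  have hint := integrable_one_sub_cos_mul hν hn ξ
  have hcos (x : V) : 0 ≤ 1 - Real.cos ⟪ξ, x⟫ := by linarith [Real.cos_le_one ⟪ξ, x⟫]
  rw [exponent_eq_integral_density hn]
  calc κ * k * ((1 / 4) ^ D * v) * f R = ∫ x in B, κ * (k * (f R * R ^ D)) := by
        rw [setIntegral_const, hvol, smul_eq_mul]
        field_simp
    _ ≤ ∫ x in B, (1 - Real.cos ⟪ξ, x⟫) * n x := by
        refine setIntegral_mono_on (integrableOn_const measure_ball_lt_top.ne) hint.integrableOn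
          measurableSet_ball fun x hx => ?_
        have hd : ‖x - x₀‖ < 1 / (4 * R) := by simpa [B, dist_eq_norm] using hx
        have hin : |⟪ξ, x⟫ - 1 / 2| ≤ 1 / 4 := by
          rw [← hin₀, ← inner_sub_right]
          refine (abs_real_inner_le_norm _ _).trans ?_
          calc ‖ξ‖ * ‖x - x₀‖ ≤ R * (1 / (4 * R)) := by gcongr
            _ = 1 / 4 := by field_simp
        rw [abs_le] at hin
        have hxne : x ≠ 0 := by
          rintro rfl
          rw [inner_zero_right] at hin
          linarith [hin.1]
        have hx0 : 0 < ‖x‖ := norm_pos_iff.2 hxne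
        have hxR : ‖x‖ ≤ 1 / R := by
          have h1 : ‖x‖ ≤ ‖x - x₀‖ + ‖x₀‖ := by simpa using norm_add_le (x - x₀) x₀
          have h2 : 1 / (4 * R) + 1 / (2 * R) ≤ 1 / R := by
            rw [← sub_nonneg]
            have : 1 / R - (1 / (4 * R) + 1 / (2 * R)) = 1 / (4 * R) := by field_simp; norm_num
            rw [this]; positivity
          linarith
        have hRx : R ≤ 1 / ‖x‖ := by
          rw [le_div_iff₀ hx0]
          rw [le_div_iff₀ hR] at hxR
          linarith
        have hθx : θ * ‖x‖ < 1 := by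
          rw [le_div_iff₀ hx0] at hRx
          nlinarith
        have h1 : κ ≤ 1 - Real.cos ⟪ξ, x⟫ := by
          have : Real.cos ⟪ξ, x⟫ ≤ Real.cos (1 / 4) :=
            Real.cos_le_cos_of_nonneg_of_le_pi (by norm_num)
              (by linarith [Real.pi_gt_three, hin.2]) (by linarith [hin.1])
          simp only [κ]; linarith
        have h2 : k * (f R * R ^ D) ≤ n x := by
          refine le_trans ?_ (hf x hxne hθx)
          have h3 : f R ≤ f (1 / ‖x‖) := hf_mono hR (by simpa using hxne) hRx
          have h4 : R ^ D ≤ (1 / ‖x‖) ^ D := by gcongr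
          rw [div_eq_mul_inv (f (1 / ‖x‖)), ← inv_pow, ← one_div]
          have := hf_pos R hR
          gcongr
          exact this.le.trans h3
        exact mul_le_mul h1 h2 (by positivity) (hcos x)
    _ ≤ ∫ x, (1 - Real.cos ⟪ξ, x⟫) * n x :=
        setIntegral_le_integral hint (Eventually.of_forall fun x => mul_nonneg (hcos x) (hn.nonneg x))

/-- The characteristic exponent is comparable with the profile of the Lévy density. -/
theorem comparableOn_exponent [Nontrivial V] {ν : Measure V} {n ψ : V → ℝ}
    (hν : IsLevyMeasure ν) (hn : HasDensity ν n)
    (hψ : ∀ ξ, ψ ξ = ∫ x, (1 - Real.cos ⟪ξ, x⟫) ∂ν) {θ a b cl Cu k K : ℝ} {f : ℝ → ℝ}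
    (hθ : 0 ≤ θ) (ha : 0 < a) (hb : b < 2) (hcl : 0 < cl) (hCu : 0 ≤ Cu) (hk : 0 < k) (hK : 0 ≤ K)
    (hf_mono : MonotoneOn f (Set.Ioi 0)) (hf_pos : ∀ r, 0 < r → 0 < f r)
    (hlower : WLSC a θ cl f) (hupper : WUSC b θ Cu f)
    (hf : ∀ x : V, x ≠ 0 → θ * ‖x‖ < 1 →
      k * (f (1 / ‖x‖) / ‖x‖ ^ Module.finrank ℝ V) ≤ n x ∧
        n x ≤ K * (f (1 / ‖x‖) / ‖x‖ ^ Module.finrank ℝ V)) :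
    ComparableOn {ξ : V | θ < ‖ξ‖} (fun ξ => f ‖ξ‖) ψ := by
  obtain ⟨C₁, hC₁, h₁⟩ := exists_exponent_le hν hn hθ ha hb hcl hCu hK hf_mono hf_pos hlower
    hupper fun x hx hxθ => (hf x hx hxθ).2
  obtain ⟨C₂, hC₂, h₂⟩ := exists_le_exponent hν hn hθ hk hf_mono hf_pos
    fun x hx hxθ => (hf x hx hxθ).1
  refine ⟨fun ξ hξ => ⟨(hf_pos _ (hθ.trans_lt hξ)).le, ?_⟩, max C₁ C₂⁻¹, by positivity,
    fun ξ hξ => ?_⟩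
  · rw [hψ]
    exact integral_nonneg fun x => sub_nonneg.2 (Real.cos_le_one _)
  · have hfξ := hf_pos _ (hθ.trans_lt hξ)
    rw [hψ]
    constructor
    · refine le_trans ?_ (h₂ ξ hξ)
      gcongr
      rw [inv_le_comm₀ (by positivity) hC₂]
      exact le_max_right _ _
    · refine (h₁ ξ hξ).trans ?_
      gcongr
      exact le_max_left _ _

end ExponentBounds

/-! ### Construction of the comparison process -/

section Construction

variable {a b cl Cu : ℝ} {g : ℝ → ℝ}

/-- Under the square root the index `b ≤ 2` becomes at most `1`, hence linear growth; the summand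
`1` covers `s ≤ t`. -/
theorem WUSC.comp_sqrt_le (hupper : WUSC b 0 Cu g) (hb : b ≤ 2) (hCu : 0 ≤ Cu)
    (hg : Monotone g) (hg_pos : ∀ r, 0 < r → 0 < g r) {s t : ℝ} (hs : 0 < s) (ht : 0 < t) :
    g (√s) ≤ g (√t) * (1 + Cu * (s / t)) := by
  have hgt := hg_pos (√t) (Real.sqrt_pos.2 ht)
  have hst : 0 < s / t := by positivity
  rcases le_total s t with h | h
  · have h1 : g (√s) ≤ g (√t) := hg (Real.sqrt_le_sqrt h)
    have h2 : 0 ≤ g (√t) * (Cu * (s / t)) := by positivity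
    linarith
  · have hl : 1 ≤ s / t := by rwa [le_div_iff₀ ht, one_mul]
    have hl' : 1 ≤ √(s / t) := by rwa [Real.one_le_sqrt]
    have h1 := hupper (√(s / t)) (√t) hl' (Real.sqrt_pos.2 ht)
    rw [← Real.sqrt_mul hst.le, div_mul_cancel₀ _ ht.ne'] at h1
    have h2 : √(s / t) ^ b ≤ s / t := by
      refine (Real.rpow_le_rpow_of_exponent_le hl' hb).trans (le_of_eq ?_)
      rw [Real.rpow_two, Real.sq_sqrt hst.le]
    calc g (√s) ≤ Cu * √(s / t) ^ b * g (√t) := h1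
      _ ≤ Cu * (s / t) * g (√t) := by gcongr
      _ ≤ g (√t) * (1 + Cu * (s / t)) := by linarith

theorem WLSC.comp_sqrt_inv_le (hlower : WLSC a 0 cl g) (hcl : 0 < cl) {u : ℝ} (hu : 1 < u) :
    g (√(1 / u)) ≤ cl⁻¹ * g 1 * u ^ (-(a / 2)) := by
  have hu0 : 0 < u := by linarith
  have h1 := hlower (√u) (√(1 / u)) (Real.one_le_sqrt.2 hu.le) (Real.sqrt_pos.2 (by positivity))
  rw [← Real.sqrt_mul hu0.le, mul_one_div_cancel hu0.ne', Real.sqrt_one] at h1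
  have h2 : √u ^ a = u ^ (a / 2) := by
    rw [Real.sqrt_eq_rpow, ← Real.rpow_mul hu0.le]; ring_nf
  rw [h2] at h1
  rw [Real.rpow_neg hu0.le]
  have hp : 0 < u ^ (a / 2) := by positivity
  calc g (√(1 / u)) = cl⁻¹ * (cl * u ^ (a / 2) * g (√(1 / u))) * (u ^ (a / 2))⁻¹ := by field_simp
    _ ≤ _ := by gcongr

theorem WUSC.comp_sqrt_inv_le (hupper : WUSC b 0 Cu g) {u : ℝ} (hu : 0 < u) (hu1 : u ≤ 1) :
    g (√(1 / u)) ≤ Cu * g 1 * u ^ (-(b / 2)) := by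
  have h1 := hupper (√(1 / u)) 1
    (Real.one_le_sqrt.2 (by rw [le_div_iff₀ hu]; linarith)) one_pos
  have h2 : √(1 / u) ^ b = u ^ (-(b / 2)) := by
    rw [one_div, Real.sqrt_inv, Real.inv_rpow (Real.sqrt_nonneg u), Real.sqrt_eq_rpow,
      ← Real.rpow_mul hu.le, ← Real.rpow_neg hu.le]
    ring_nf
  rw [mul_one, h2] at h1
  linarith

/-- A complete subordinate Brownian motion whose Lévy density is comparable with
`g (1 / ‖x‖) / ‖x‖ ^ d`. -/
theorem exists_subordinate_comparable {V : Type*} [NormedAddCommGroup V] [InnerProductSpace ℝ V]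
    [FiniteDimensional ℝ V] [MeasurableSpace V] [BorelSpace V] [Nontrivial V]
    (ha : 0 < a) (hb : b < 2) (hcl : 0 < cl) (hCu : 0 ≤ Cu) (hg : Monotone g)
    (hg_pos : ∀ r, 0 < r → 0 < g r) (hlower : WLSC a 0 cl g) (hupper : WUSC b 0 Cu g) :
    ∃ (q : ℝ≥0 → Measure V) (ν : Measure V) (n ψ : V → ℝ) (k K : ℝ), 0 < k ∧ 0 < K ∧
      IsCompleteSubordinateBrownianMotion q ∧ IsSymmetricPureJumpLevy q ν ψ ∧ HasDensity ν n ∧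
      ∀ x : V, x ≠ 0 → k * (g (1 / ‖x‖) / ‖x‖ ^ Module.finrank ℝ V) ≤ n x ∧
        n x ≤ K * (g (1 / ‖x‖) / ‖x‖ ^ Module.finrank ℝ V) := by
  set F : ℝ → ℝ := fun s => g (√s) with hFdef
  have hF : Monotone F := hg.comp Real.sqrt_monotone
  have hF0 : ∀ s, 0 < s → 0 ≤ F s := fun s hs => (hg_pos _ (Real.sqrt_pos.2 hs)).le
  have hC : ∀ s t, 0 < s → 0 < t → F s ≤ F t * (1 + Cu * (s / t)) := fun s t hs ht =>
    hupper.comp_sqrt_le hb.le hCu hg hg_pos hs ht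
  have hcm := isCompletelyMonotone_laplaceTransform hF.measurable hF0
    fun u hu => integrableOn_exp_mul_of_linear_growth hF.measurable hF0 hC hu
  have hint : IntegrableOn (fun u => min 1 u * laplaceTransform F u) (Set.Ioi 0) :=
    integrableOn_min_mul_laplaceTransform hF.measurable hF0 hCu hC (a := a / 2) (b := b / 2)
      (by positivity) (by linarith) (fun u hu => hlower.comp_sqrt_inv_le hcl hu)
      (fun u hu hu1 => hupper.comp_sqrt_inv_le hu hu1)
  obtain ⟨k, hk, hkle⟩ := exists_le_jumpDensity (V := V) hF hF0 hCu hC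
  obtain ⟨K, hK, hKle⟩ := exists_jumpDensity_le (V := V) hF.measurable hF0 hCu hC
  have hFx (x : V) : F (1 / ‖x‖ ^ 2) = g (1 / ‖x‖) := by
    simp only [hFdef]
    rw [← one_div_pow, Real.sqrt_sq (by positivity)]
  simp only [hFx] at hkle hKle
  have hm := measurable_laplaceTransform hF.measurable
  have hn0 := jumpDensity_nonneg (V := V) (m := laplaceTransform F)
    fun u hu => by simpa using hcm.2 0 u hu
  have hlevy : Integrable fun x : V => min (‖x‖ ^ 2) 1 * jumpDensity V (laplaceTransform F) x := by
    -- The Lévy condition is the exponent estimate at `R = 1`, with weight `min (‖x‖ ^ 2) 1`.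
    have h1 := (integrable_comp_radialMajorant (V := V) ha hb one_pos).const_mul
      (K * (2 * (Cu + cl⁻¹)) * g 1)
    refine h1.mono' ((Measurable.mul (by fun_prop)
      (measurable_jumpDensity hm)).aestronglyMeasurable) ?_
    have hne : ∀ᵐ x : V, x ≠ 0 := by
      rw [ae_iff]; simp
    filter_upwards [hne] with x hx
    rw [Real.norm_of_nonneg (mul_nonneg (by positivity) (hn0 x)), mul_assoc]
    have hm0 : 0 ≤ min (‖x‖ ^ 2) 1 := by positivity
    exact mul_density_le_radialMajorant hcl hCu hK.le hg_pos hlower hupper one_pos one_pos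
      (norm_pos_iff.2 hx) (by simp) hm0 (by rw [one_mul]; linarith) (hKle x hx)
  obtain ⟨q, ν, ψ, h1, h2, h3⟩ := exists_isSymmetricPureJumpLevy (V := V) _ hm hcm hint
    (fun x hx => integrableOn_heatKernel_mul_laplaceTransform hF.measurable hF0 hCu hC hx)
    hlevy.lintegral_lt_top
  exact ⟨q, ν, _, ψ, k, K, hk, hK, h1, h2, h3, fun x hx => ⟨hkle x hx, hKle x hx⟩⟩

/-! ### Extension of the profile below the threshold -/

/-- A function with weak scaling above `θ` agrees there with one that has global weak scaling. -/
theorem exists_global_scaling {θ α β : ℝ} {f : ℝ → ℝ} (hθ : 0 ≤ θ)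
    (hf_mono : MonotoneOn f (Set.Ioi 0)) (hf_pos : ∀ r, 0 < r → 0 < f r)
    (hα : 0 < α) (hα2 : α < 2) (hβ2 : β < 2) (hcl : 0 < cl) (hcl1 : cl ≤ 1) (hCu : 1 ≤ Cu)
    (hlower : WLSC α θ cl f) (hupper : WUSC β θ Cu f) :
    ∃ (g : ℝ → ℝ) (b c C : ℝ), Monotone g ∧ (∀ r, 0 < r → 0 < g r) ∧ (∀ r, θ < r → g r = f r) ∧
      b < 2 ∧ 0 < c ∧ 0 ≤ C ∧ WLSC α 0 c g ∧ WUSC b 0 C g := by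
  rcases hθ.eq_or_lt with rfl | hθ0
  -- For `θ = 0` the scaling is already global; the indicator only makes `f` monotone on all of `ℝ`.
  · have hg (r : ℝ) (hr : 0 < r) : (Set.Ioi 0).indicator f r = f r := Set.indicator_of_mem hr f
    refine ⟨(Set.Ioi 0).indicator f, β, cl, Cu, fun r s hrs => ?_,
      fun r hr => by rw [hg r hr]; exact hf_pos r hr, hg, hβ2, hcl, by linarith,
      fun l t hl ht => ?_, fun l t hl ht => ?_⟩
    · by_cases hr : 0 < r
      · have hs : 0 < s := hr.trans_le hrs
        rw [hg r hr, hg s hs]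
        exact hf_mono hr hs hrs
      · rw [Set.indicator_of_notMem (by simpa using hr)]
        exact Set.indicator_nonneg (fun s hs => (hf_pos s hs).le) s
    · rw [hg t ht, hg (l * t) (by positivity)]
      exact hlower l t hl ht
    · rw [hg t ht, hg (l * t) (by positivity)]
      exact hupper l t hl ht
  -- A pure power of index `α` keeps the lower index and raises the upper one to `max α β`, still
  -- below `2`. The `max r 0` makes `g` vanish, hence stay monotone, on the negative reals.
  set g : ℝ → ℝ := fun r => if r ≤ θ then f θ * (max r 0 / θ) ^ α else f r with hgdef
  have hfθ := hf_pos θ hθ0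
  have hg1 (r : ℝ) (hr : r ≤ θ) : g r = f θ * (max r 0 / θ) ^ α := if_pos hr
  have hg1' (r : ℝ) (hr : r ≤ θ) (h0 : 0 < r) : g r = f θ * (r / θ) ^ α := by
    rw [hg1 r hr, max_eq_left h0.le]
  have hg2 (r : ℝ) (hr : θ < r) : g r = f r := if_neg hr.not_ge
  -- Scaling is assumed only at points strictly above `θ`, so `2θ` is the base point and `Q`
  -- measures the growth of `f` between `θ` and `2θ`. The bounds `low` and `upp` then compare `f`
  -- with the power profile across the junction.
  set Q := f (2 * θ) / f θ
  have hQ : f (2 * θ) = Q * f θ := by simp only [Q]; field_simp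
  have hQ1 : 1 ≤ Q := by
    simp only [Q]
    rw [le_div_iff₀ hfθ, one_mul]
    exact hf_mono hθ0 (by simpa using hθ0) (by linarith)
  set b := max α β
  have hbα : α ≤ b := le_max_left _ _
  have hbβ : β ≤ b := le_max_right _ _
  have h2α : (0 : ℝ) < 2 ^ (-α) := by positivity
  have h2α1 : (2 : ℝ) ^ (-α) ≤ 1 := Real.rpow_le_one_of_one_le_of_nonpos one_le_two (by linarith)
  have hCQ : 1 ≤ Cu * Q := one_le_mul_of_one_le_of_one_le hCu hQ1
  have low (s : ℝ) (hs : θ < s) : cl * 2 ^ (-α) * ((s / θ) ^ α * f θ) ≤ f s := by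
    have hs0 : 0 < s := hθ0.trans hs
    have e : (s / θ) ^ α = 2 ^ α * (s / (2 * θ)) ^ α := by
      rw [← Real.mul_rpow zero_le_two (by positivity)]
      congr 1; field_simp
    have e2 : (2 : ℝ) ^ (-α) * 2 ^ α = 1 := by
      rw [← Real.rpow_add two_pos]; simp
    have e3 : cl * 2 ^ (-α) * ((s / θ) ^ α * f θ) = cl * (s / (2 * θ)) ^ α * f θ := by
      rw [e]
      linear_combination (cl * (s / (2 * θ)) ^ α * f θ) * e2
    rw [e3]
    rcases le_total (2 * θ) s with h | h
    · have h1 := hlower (s / (2 * θ)) (2 * θ) (by rw [le_div_iff₀ (by positivity)]; linarith)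
        (by linarith)
      rw [div_mul_cancel₀ _ (by positivity)] at h1
      refine le_trans ?_ h1
      rw [hQ]
      have : f θ ≤ Q * f θ := le_mul_of_one_le_left hfθ.le hQ1
      gcongr
    · have h1 : (s / (2 * θ)) ^ α ≤ 1 := Real.rpow_le_one (by positivity)
        (by rw [div_le_one (by positivity)]; exact h) hα.le
      calc cl * (s / (2 * θ)) ^ α * f θ ≤ 1 * 1 * f θ := by gcongr
        _ = f θ := by ring
        _ ≤ f s := hf_mono hθ0 hs0 hs.le
  have upp (s : ℝ) (hs : θ < s) : f s ≤ Cu * Q * ((s / θ) ^ b * f θ) := by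
    have hs0 : 0 < s := hθ0.trans hs
    have hsθ : 1 ≤ s / θ := by rw [le_div_iff₀ hθ0]; linarith
    rcases le_total (2 * θ) s with h | h
    · have hs2 : 1 ≤ s / (2 * θ) := by rw [le_div_iff₀ (by positivity)]; linarith
      have h1 := hupper (s / (2 * θ)) (2 * θ) hs2 (by linarith)
      rw [div_mul_cancel₀ _ (by positivity), hQ] at h1
      have h2 : (s / (2 * θ)) ^ β ≤ (s / θ) ^ b := by
        refine (Real.rpow_le_rpow_of_exponent_le hs2 hbβ).trans ?_
        apply Real.rpow_le_rpow (by positivity) _ (by linarith)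
        gcongr
        linarith
      calc f s ≤ Cu * (s / (2 * θ)) ^ β * (Q * f θ) := h1
        _ ≤ Cu * (s / θ) ^ b * (Q * f θ) := by gcongr
        _ = _ := by ring
    · have h1 : f s ≤ Q * f θ := by
        rw [← hQ]; exact hf_mono hs0 (by simpa using hθ0) h
      have h2 : 1 ≤ (s / θ) ^ b := Real.one_le_rpow hsθ (by linarith)
      calc f s ≤ 1 * Q * (1 * f θ) := by linarith
        _ ≤ _ := by gcongr
  refine ⟨g, b, cl * 2 ^ (-α), Cu * Q, fun r s hrs => ?_, fun r hr => ?_, hg2, max_lt hα2 hβ2,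
    by positivity, by linarith, fun l t hl ht => ?_, fun l t hl ht => ?_⟩
  · by_cases hs : s ≤ θ
    · rw [hg1 r (hrs.trans hs), hg1 s hs]
      gcongr
    · push Not at hs
      rw [hg2 s hs]
      by_cases hr : r ≤ θ
      · rw [hg1 r hr]
        have h1 : (max r 0 / θ) ^ α ≤ 1 := Real.rpow_le_one (by positivity)
          (by rw [div_le_one hθ0]; exact max_le hr hθ) hα.le
        calc f θ * (max r 0 / θ) ^ α ≤ f θ * 1 := by gcongr
          _ ≤ f s := by rw [mul_one]; exact hf_mono hθ0 (hθ0.trans hs) hs.le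
      · push Not at hr
        rw [hg2 r hr]
        exact hf_mono (hθ0.trans hr) (hθ0.trans hs) hrs
  · by_cases h : r ≤ θ
    · rw [hg1' r h hr]; positivity
    · push Not at h
      rw [hg2 r h]; exact hf_pos r hr
  · have hl0 : 0 < l := by linarith
    by_cases h1 : l * t ≤ θ
    · have h2 : t ≤ θ := by nlinarith
      rw [hg1' _ h1 (by positivity), hg1' t h2 ht, mul_div_assoc,
        Real.mul_rpow hl0.le (by positivity)]
      have h3 : cl * 2 ^ (-α) ≤ 1 := mul_le_one₀ hcl1 h2α.le h2α1
      calc cl * 2 ^ (-α) * l ^ α * (f θ * (t / θ) ^ α)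
          ≤ 1 * l ^ α * (f θ * (t / θ) ^ α) := by gcongr
        _ = _ := by ring
    · push Not at h1
      rw [hg2 _ h1]
      by_cases h2 : t ≤ θ
      · rw [hg1' t h2 ht]
        refine le_trans (le_of_eq ?_) (low _ h1)
        rw [mul_div_assoc, Real.mul_rpow hl0.le (by positivity)]
        ring
      · push Not at h2
        rw [hg2 t h2]
        refine le_trans ?_ (hlower l t hl h2)
        have := hf_pos t ht
        have h3 : cl * 2 ^ (-α) ≤ cl := mul_le_of_le_one_right hcl.le h2α1
        gcongr
  · have hl0 : 0 < l := by linarith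
    by_cases h1 : l * t ≤ θ
    · have h2 : t ≤ θ := by nlinarith
      rw [hg1' _ h1 (by positivity), hg1' t h2 ht, mul_div_assoc,
        Real.mul_rpow hl0.le (by positivity)]
      have h3 : l ^ α ≤ l ^ b := Real.rpow_le_rpow_of_exponent_le hl hbα
      calc f θ * (l ^ α * (t / θ) ^ α) = 1 * l ^ α * (f θ * (t / θ) ^ α) := by ring
        _ ≤ _ := by gcongr
    · push Not at h1
      rw [hg2 _ h1]
      by_cases h2 : t ≤ θ
      · rw [hg1' t h2 ht]
        refine (upp _ h1).trans ?_
        rw [mul_div_assoc, Real.mul_rpow hl0.le (by positivity)]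
        have h3 : (t / θ) ^ b ≤ (t / θ) ^ α :=
          Real.rpow_le_rpow_of_exponent_ge (by positivity) (by rw [div_le_one hθ0]; exact h2) hbα
        calc Cu * Q * (l ^ b * (t / θ) ^ b * f θ) ≤ Cu * Q * (l ^ b * (t / θ) ^ α * f θ) := by
              gcongr
          _ = _ := by ring
      · push Not at h2
        rw [hg2 t h2]
        refine (hupper l t hl h2).trans ?_
        have := hf_pos t ht
        have h3 : Cu ≤ Cu * Q := le_mul_of_one_le_right (by linarith) hQ1
        have h4 : l ^ β ≤ l ^ b := Real.rpow_le_rpow_of_exponent_le hl hbβ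
        gcongr

/-! ### Comparability relations and the conclusion -/

theorem ComparableOn.symm {X : Type*} {S : Set X} {g h : X → ℝ} (hgh : ComparableOn S g h) :
    ComparableOn S h g := by
  obtain ⟨h0, C, hC, h1⟩ := hgh
  refine ⟨fun x hx => (h0 x hx).symm, C, hC, fun x hx => ⟨?_, ?_⟩⟩
  · rw [inv_mul_le_iff₀ hC]; exact (h1 x hx).2
  · rw [← inv_mul_le_iff₀ hC]; exact (h1 x hx).1

theorem ComparableOn.trans {X : Type*} {S : Set X} {g h k : X → ℝ} (hgh : ComparableOn S g h)
    (hhk : ComparableOn S h k) : ComparableOn S g k := by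
  obtain ⟨h0, C, hC, h1⟩ := hgh
  obtain ⟨h0', C', hC', h1'⟩ := hhk
  refine ⟨fun x hx => ⟨(h0 x hx).1, (h0' x hx).2⟩, C' * C, by positivity, fun x hx => ⟨?_, ?_⟩⟩
  · rw [mul_inv, mul_assoc]
    refine le_trans ?_ (h1' x hx).1
    gcongr
    exact (h1 x hx).1
  · refine (h1' x hx).2.trans ?_
    rw [mul_assoc]
    gcongr
    exact (h1 x hx).2

theorem comparableOn_of_bounds {X : Type*} {S : Set X} {g h : X → ℝ} {k K : ℝ} (hk : 0 < k)
    (hg : ∀ x ∈ S, 0 ≤ g x) (hgh : ∀ x ∈ S, k * g x ≤ h x ∧ h x ≤ K * g x) :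
    ComparableOn S g h := by
  refine ⟨fun x hx => ⟨hg x hx, (mul_nonneg hk.le (hg x hx)).trans (hgh x hx).1⟩, max K k⁻¹,
    by positivity, fun x hx => ⟨?_, ?_⟩⟩
  · refine le_trans ?_ (hgh x hx).1
    have := hg x hx
    gcongr
    rw [inv_le_comm₀ (by positivity) hk]
    exact le_max_right _ _
  · refine (hgh x hx).2.trans ?_
    have := hg x hx
    gcongr
    exact le_max_left _ _

end Construction

end SubordinateBrownianMotion

theorem mainTheorem7 (d : ℕ) (hd : 1 ≤ d)
    (p : ℝ≥0 → Measure (EuclideanSpace ℝ (Fin d))) (ν : Measure (EuclideanSpace ℝ (Fin d)))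
    (n ψ : EuclideanSpace ℝ (Fin d) → ℝ)
    (hX : IsSymmetricPureJumpLevy p ν ψ) (hn : HasDensity ν n)
    (θ c : ℝ) (hθ : 0 ≤ θ) (hc : 0 < c) (hc1 : c ≤ 1)
    (f : ℝ → ℝ) (hf_mono : MonotoneOn f (Set.Ioi 0)) (hf_pos : ∀ r, 0 < r → 0 < f r)
    -- `θ * ‖x‖ < 1` reads `‖x‖ < 1 / θ`, which is no restriction if `θ = 0`
    (hf : ∀ x : EuclideanSpace ℝ (Fin d), x ≠ 0 → θ * ‖x‖ < 1 →
      c * (f (1 / ‖x‖) / ‖x‖ ^ d) ≤ n x ∧ n x ≤ c⁻¹ * (f (1 / ‖x‖) / ‖x‖ ^ d))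
    (α β cl Cu : ℝ) (hα : 0 < α) (hα2 : α < 2) (hβ : 0 < β) (hβ2 : β < 2)
    (hcl : 0 < cl) (hcl1 : cl ≤ 1) (hCu : 1 ≤ Cu)
    (hlower : WLSC α θ cl f) (hupper : WUSC β θ Cu f) :
    ComparableOn {ξ : EuclideanSpace ℝ (Fin d) | θ < ‖ξ‖} (fun ξ => f ‖ξ‖) ψ ∧
    ∃ (q : ℝ≥0 → Measure (EuclideanSpace ℝ (Fin d))) (νZ : Measure (EuclideanSpace ℝ (Fin d)))
      (nZ ψZ : EuclideanSpace ℝ (Fin d) → ℝ),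
      IsCompleteSubordinateBrownianMotion q ∧
      IsSymmetricPureJumpLevy q νZ ψZ ∧ HasDensity νZ nZ ∧
      ComparableOn {ξ : EuclideanSpace ℝ (Fin d) | θ < ‖ξ‖} ψ ψZ ∧
      ComparableOn {x : EuclideanSpace ℝ (Fin d) | x ≠ 0 ∧ θ * ‖x‖ < 1} n nZ := by
  have : Nonempty (Fin d) := ⟨⟨0, hd⟩⟩
  have hdim : Module.finrank ℝ (EuclideanSpace ℝ (Fin d)) = d := by simp
  have hψ := comparableOn_exponent hX.levyMeasure hn hX.exponent_eq hθ hα hβ2 hcl (by linarith) hc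
    (inv_nonneg.2 hc.le) hf_mono hf_pos hlower hupper (by simpa only [hdim] using hf)
  refine ⟨hψ, ?_⟩
  obtain ⟨g, b, c', C', hg_mono, hg_pos, hgf, hb2, hc', hC', hglower, hgupper⟩ :=
    exists_global_scaling hθ hf_mono hf_pos hα hα2 hβ2 hcl hcl1 hCu hlower hupper
  obtain ⟨q, νZ, nZ, ψZ, k, K, hk, hK, hq, hZ, hnZ, hbound⟩ :=
    exists_subordinate_comparable (V := EuclideanSpace ℝ (Fin d)) hα hb2 hc' hC' hg_mono hg_pos
      hglower hgupper
  -- Threshold `0` is admissible because `g` scales globally; restriction to `‖ξ‖ > θ` afterwards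
  -- turns `g` into `f`.
  have hψZ := comparableOn_exponent hZ.levyMeasure hnZ hZ.exponent_eq le_rfl hα hb2 hc' hC' hk
    hK.le (hg_mono.monotoneOn _) hg_pos hglower hgupper fun x hx _ => hbound x hx
  refine ⟨q, νZ, nZ, ψZ, hq, hZ, hnZ, hψ.symm.trans ?_, ?_⟩
  · obtain ⟨h0, C, hC, h1⟩ := hψZ
    refine ⟨fun ξ hξ => ?_, C, hC, fun ξ hξ => ?_⟩
    · simpa only [hgf ‖ξ‖ hξ] using h0 ξ (hθ.trans_lt hξ)
    · simpa only [hgf ‖ξ‖ hξ] using h1 ξ (hθ.trans_lt hξ)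
  · have hnn : ∀ x : EuclideanSpace ℝ (Fin d), x ≠ 0 ∧ θ * ‖x‖ < 1 →
        0 ≤ f (1 / ‖x‖) / ‖x‖ ^ d := fun x hx => by
      have := hf_pos (1 / ‖x‖) (one_div_pos.2 (norm_pos_iff.2 hx.1))
      positivity
    refine (comparableOn_of_bounds hc hnn fun x hx => hf x hx.1 hx.2).symm.trans
      (comparableOn_of_bounds (K := K) hk hnn fun x hx => ?_)
    have h1 := hbound x hx.1
    have hx0 : θ < 1 / ‖x‖ := by
      rw [lt_div_iff₀ (norm_pos_iff.2 hx.1)]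
      exact hx.2
    rwa [hgf _ hx0, hdim] at h1
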